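/- Let $\tau$ be a continuous language: function and relation symbols with finite arities and, for each symbol $s$, a modulus of uniform continuity $\Delta_s(r)>0$ ($r\in\mathbb{Q}\cap(0,1]$). A continuous $\tau$-structure is a nonempty complete metric space of diameter at most $1$ with functions and $[0,1]$-valued relations such that $d(x_i,y_i)<\Delta_s(r)$ for all $i$ implies $d(s(\mathbf x),s(\mathbf y))\le r$, respectively $|s(\mathbf x)-s(\mathbf y)|\le r$. Continuous formulas are built from $d(t,t')$ and $R(\mathbf t)$ ($t,t',\mathbf t$ terms) by the connectives $0$, $1$, $x/2$, $x\dot- y=\max(x-y,0)$ and the quantifiers $\sup_x$, $\inf_x$. A continuous theory $T$ is a set of conditions $\varphi=0$, $\varphi$ a sentence; it is complete if it has a model and all its models give each sentence the same value. An elementary embedding is a map that preserves the values of all continuous formulas. Put $\mathbb{Q}'=\mathbb{Q}\cap[0,1]$. The discrete language $\tau^+$ has the function symbols of $\tau$ and, for every continuous formula $\varphi(\mathbf x)$ and $r\in\mathbb{Q}'$, relation symbols $R_{\varphi\ge r}$, $R_{\varphi\le r}$ of arity $\ell(\mathbf x)$. A subset $S$ of a continuous structure $M$ is nicely dense if it is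 dense and closed under the functions of $M$; then $M_S$ is the $\tau^+$-structure with universe $S$, the restricted functions, and $M_S\models R_{\varphi\,\square\, r}[\mathbf a]\iff\varphi^M(\mathbf a)\,\square\, r$ for $\square\in\{\ge,\le\}$. We say that $M$ is the completion of a $\tau^+$-structure $A$ along a map $i:A\to M$, and write $M=\overline A$, if $i$ is an isomorphism of $A$ onto $M_S$ for some nicely dense $S\subseteq M$. $T_{dense}$ is the $\mathbb{L}_{\omega_1,\omega}(\tau^+)$-theory that consists of the universal closures of the following, for all continuous formulas $\varphi,\psi$ and all $r,s\in\mathbb{Q}'$, where $R_{\varphi\ge q}$ is read as true for $q<0$ and false for $q>1$, $R_{\varphi\le q}$ as false for $q<0$ and true for $q>1$, and $n$ ranges over the positive integers. (1) $\neg R_{\varphi\ge r}\to R_{\varphi\le r}$; $\neg R_{\varphi\le r}\to R_{\varphi\ge r}$; $\neg R_{\varphi\ge r}\vee\neg R_{\varphi\le s}$ if $r>s$; $R_{\varphi\le s}\to R_{\varphi\le r}$ and $R_{\varphi\ge r}\to R_{\varphi\ge s}$ if $r\ge s$; $R_{\varphi\ge r}\vee R_{\varphi\le r}$; $\bigwedge_n\bigvee_{|r-s|<1/n}(R_{\varphi\le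 r}\wedge R_{\varphi\ge s})$; $\bigwedge_n R_{\varphi\ge r-1/n}\to R_{\varphi\ge r}$; $\bigwedge_n R_{\varphi\le r+1/n}\to R_{\varphi\le r}$. (2) $R_{\varphi\ge0}\wedge R_{\varphi\le1}$; $\neg R_{0\ge t}\wedge\neg R_{1\le1-t}$ for $t\in\mathbb{Q}'$, $t>0$; $R_{\varphi/2\,\square\, r}\leftrightarrow R_{\varphi\,\square\,2r}$; $R_{\varphi\dot-\psi\ge r}\leftrightarrow\bigwedge_n\bigvee_{s\in\mathbb{Q}'}(R_{\psi\le s}\wedge R_{\varphi\ge r+s-1/n})$ for $r>0$; $R_{\varphi\dot-\psi\le r}\leftrightarrow\bigwedge_n\bigvee_{s\in\mathbb{Q}'}(R_{\psi\ge s}\wedge R_{\varphi\le r+s+1/n})$; $R_{\sup_y\varphi\le r}(\mathbf x)\leftrightarrow\forall x\,R_{\varphi\le r}(x,\mathbf x)$; $R_{\sup_y\varphi\ge r}(\mathbf x)\leftrightarrow\bigwedge_n\exists x\,R_{\varphi\ge r-1/n}(x,\mathbf x)$; $R_{\inf_y\varphi\le r}(\mathbf x)\leftrightarrow\bigwedge_n\exists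 x\,R_{\varphi\le r+1/n}(x,\mathbf x)$; $R_{\inf_y\varphi\ge r}(\mathbf x)\leftrightarrow\forall x\,R_{\varphi\ge r}(x,\mathbf x)$; $R_{\varphi\,\square\, r}(\mathbf t(\mathbf x))\leftrightarrow R_{\varphi(\mathbf t)\,\square\, r}(\mathbf x)$ for terms $\mathbf t$. (3) $R_{d\le0}(x,x')\leftrightarrow x=x'$; $R_{d\,\square\, r}(x,x')\leftrightarrow R_{d\,\square\, r}(x',x)$; $R_{d\ge r}(x,x')\to\forall x''\bigwedge_n\bigvee_{s\in\mathbb{Q}'\cap[0,r]}(R_{d\ge s}(x,x'')\wedge R_{d\ge r-s-1/n}(x'',x'))$. (4) For $r>0$ and $s<\Delta_F(r)$: $\bigwedge_iR_{d\le s}(x_i,y_i)\to R_{d\le r}(F(\mathbf x),F(\mathbf y))$. For $r>0$ and $s<\Delta_R(r)$: $\bigwedge_iR_{d\le s}(x_i,y_i)\to R_{R(\mathbf z)\dot-R(\mathbf z')\le r}(\mathbf x,\mathbf y)\wedge R_{R(\mathbf z)\dot-R(\mathbf z')\le r}(\mathbf y,\mathbf x)$. For a continuous theory $T$ let $T^*=T_{dense}\cup\{R_{\varphi\le0}:(\varphi=0)\in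 T\}$, and let $K=(\mathrm{Mod}(T^*),\subset_{\tau^+})$ be the class of its nonempty models, ordered by the substructure relation. **Theorem.** Let $T$ be a complete continuous first-order $\tau$-theory. Then: 1. $K$ is an Abstract Elementary Class. 2. $K$ has amalgamation over sets (any $M_1,M_2\in K$ can be amalgamated over any set $A$, mapped into both, that has the same quantifier-free $\tau^+$-type in $M_1$ and in $M_2$) and joint embedding; and if $T$ has a non-compact model, then $K$ has no maximal models. 3. Galois types in $K$ correspond to continuous syntactic types of $T$. In detail: if $M\models T$ and $S\subseteq M$ is nicely dense, then $M_S\in K$; every $A\in K$ has a completion $\overline A\models T$; and if $A\in K$ with completion $M=\overline A$ along $i$, $C\subseteq A$, $i(C)\subseteq B\subseteq\overline{i(C)}$ (closure in $M$; for example $C=A$ and $B=M$), and $\iota$ is an index set, then there is a bijection $\Phi$ from the set of Galois types over $C$ of $\iota$-tuples in members of $K$ that extend $A$ onto the set of complete continuous types in variables $\iota$ over $B$ (the types of $\iota$-tuples in models of the theory of $(M,b)_{b\in B}$), with the following property. Let $f:A\to N$ be an embedding with $N\in K$, let $\mathbf a\in N^\iota$, and let $\overline N$ be a completion of $N$ along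 $j$. Then there is an elementary embedding $h:M\to\overline N$ with $h\circ i=j\circ f$ and $$\Phi(\mathrm{gtp}_K(\mathbf a/C;N))=\mathrm{tp}^{\overline N}(j(\mathbf a)/B),$$ where the parameters $b\in B$ are interpreted as $h(b)$. -/

import Mathlib

open FirstOrder FirstOrder.Language Set

universe u v w

namespace ContLogic

/-! ## Discrete infinitary logic -/

/-- Formulas of the infinitary logic with countable conjunctions and disjunctions and finite
strings of quantifiers, over a discrete language `L`, with free variables `x_0, …, x_{n-1}`.
The quantifiers bind the last variable. -/
inductive InfFormula (L : FirstOrder.Language.{u, u}) : ℕ → Type (max 1 u)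
  | equal {n : ℕ} (s t : L.Term (Fin n)) : InfFormula L n
  | rel {n l : ℕ} (R : L.Relations l) (ts : Fin l → L.Term (Fin n)) : InfFormula L n
  | neg {n : ℕ} (φ : InfFormula L n) : InfFormula L n
  | iAnd {n : ℕ} {ι : Type} [Countable ι] (φ : ι → InfFormula L n) : InfFormula L n
  | iOr {n : ℕ} {ι : Type} [Countable ι] (φ : ι → InfFormula L n) : InfFormula L n
  | all {n : ℕ} (φ : InfFormula L (n + 1)) : InfFormula L n
  | ex {n : ℕ} (φ : InfFormula L (n + 1)) : InfFormula L n

namespace InfFormula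

variable {L : FirstOrder.Language.{u, u}}

/-- The true formula (empty conjunction). -/
def tru {n : ℕ} : InfFormula L n := iAnd (fun i : Empty => i.elim)

/-- The false formula (empty disjunction). -/
def fls {n : ℕ} : InfFormula L n := iOr (fun i : Empty => i.elim)

def and {n : ℕ} (φ ψ : InfFormula L n) : InfFormula L n := iAnd (fun b : Bool => cond b φ ψ)

def or {n : ℕ} (φ ψ : InfFormula L n) : InfFormula L n := iOr (fun b : Bool => cond b φ ψ)

def imp {n : ℕ} (φ ψ : InfFormula L n) : InfFormula L n := or (neg φ) ψ

def iff {n : ℕ} (φ ψ : InfFormula L n) : InfFormula L n := and (imp φ ψ) (imp ψ φ)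

/-- Universal closure. -/
def alls : {n : ℕ} → InfFormula L n → InfFormula L 0
  | 0, φ => φ
  | _ + 1, φ => alls (all φ)

/-- Tarskian satisfaction. -/
def Realize {M : Type w} [L.Structure M] : {n : ℕ} → InfFormula L n → (Fin n → M) → Prop
  | _, equal s t, x => s.realize x = t.realize x
  | _, rel R ts, x => Structure.RelMap R (fun i => (ts i).realize x)
  | _, neg φ, x => ¬ φ.Realize x
  | _, iAnd φ, x => ∀ i, (φ i).Realize x
  | _, iOr φ, x => ∃ i, (φ i).Realize x
  | _, all φ, x => ∀ a : M, φ.Realize (Fin.snoc x a : Fin (_ + 1) → M)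
  | _, ex φ, x => ∃ a : M, φ.Realize (Fin.snoc x a : Fin (_ + 1) → M)

end InfFormula

/-- `M` is a model of the infinitary theory `T`. -/
def InfModels {L : FirstOrder.Language.{u, u}} (M : Type w) [L.Structure M] (T : Set (InfFormula L 0)) :
    Prop :=
  ∀ σ ∈ T, σ.Realize (M := M) Fin.elim0

/-! ## Continuous first-order logic -/

/-- A continuous language: function and relation symbols, with their arities and their moduli of
uniform continuity. The moduli are prescribed at rational `r ∈ (0, 1]`. -/
structure CLanguage where
  Func : ℕ → Type u
  Rel : ℕ → Type u
  funMod : ∀ {n : ℕ}, Func n → ℚ → ℝ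
  relMod : ∀ {n : ℕ}, Rel n → ℚ → ℝ
  funMod_pos : ∀ {n : ℕ} (F : Func n) (r : ℚ), 0 < r → r ≤ 1 → 0 < funMod F r
  relMod_pos : ∀ {n : ℕ} (R : Rel n) (r : ℚ), 0 < r → r ≤ 1 → 0 < relMod R r

/-- The discrete language that has just the function symbols of `τ`; its terms are the terms
of `τ`. -/
def CLanguage.funLang (τ : CLanguage.{u}) : FirstOrder.Language.{u, u} := ⟨τ.Func, fun _ => PEmpty⟩

/-- Continuous formulas in the free variables `x_0, …, x_{n-1}`, built with the full set of
connectives `0`, `1`, `x / 2`, `x ∸ y`. The quantifiers `sup` and `inf` bind the last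
variable. -/
inductive CFormula (τ : CLanguage.{u}) : ℕ → Type u
  | dist {n : ℕ} (s t : τ.funLang.Term (Fin n)) : CFormula τ n
  | rel {n l : ℕ} (R : τ.Rel l) (ts : Fin l → τ.funLang.Term (Fin n)) : CFormula τ n
  | zero {n : ℕ} : CFormula τ n
  | one {n : ℕ} : CFormula τ n
  | half {n : ℕ} (φ : CFormula τ n) : CFormula τ n
  | monus {n : ℕ} (φ ψ : CFormula τ n) : CFormula τ n
  | sup {n : ℕ} (φ : CFormula τ (n + 1)) : CFormula τ n
  | inf {n : ℕ} (φ : CFormula τ (n + 1)) : CFormula τ n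

/-- Simultaneous substitution of the terms `t i` for the free variables `x_i`. -/
def CFormula.subst {τ : CLanguage.{u}} :
    {n m : ℕ} → CFormula τ n → (Fin n → τ.funLang.Term (Fin m)) → CFormula τ m
  | _, _, .dist s s', t => .dist (s.subst t) (s'.subst t)
  | _, _, .rel R ts, t => .rel R (fun i => (ts i).subst t)
  | _, _, .zero, _ => .zero
  | _, _, .one, _ => .one
  | _, _, .half φ, t => .half (φ.subst t)
  | _, _, .monus φ ψ, t => .monus (φ.subst t) (ψ.subst t)
  | n, m, .sup φ, t => .sup (φ.subst
      (Fin.snoc (fun i => (t i).relabel Fin.castSucc) (Term.var (Fin.last m)) :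
        Fin (n + 1) → τ.funLang.Term (Fin (m + 1))))
  | n, m, .inf φ, t => .inf (φ.subst
      (Fin.snoc (fun i => (t i).relabel Fin.castSucc) (Term.var (Fin.last m)) :
        Fin (n + 1) → τ.funLang.Term (Fin (m + 1))))

/-- Continuous `τ`-structures: nonempty complete metric spaces of diameter at most `1` with
functions and `[0, 1]`-valued relations that obey the moduli of uniform continuity. -/
structure CStructure (τ : CLanguage.{u}) where
  Carrier : Type u
  [metric : MetricSpace Carrier]
  [complete : CompleteSpace Carrier]
  [nonempty : Nonempty Carrier]
  dist_le_one : ∀ x y : Carrier, dist x y ≤ 1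
  func : ∀ {n : ℕ}, τ.Func n → (Fin n → Carrier) → Carrier
  rel : ∀ {n : ℕ}, τ.Rel n → (Fin n → Carrier) → ℝ
  rel_mem : ∀ {n : ℕ} (R : τ.Rel n) (x : Fin n → Carrier), rel R x ∈ Icc (0 : ℝ) 1
  func_unif : ∀ {n : ℕ} (F : τ.Func n) (r : ℚ), 0 < r → r ≤ 1 → ∀ x y : Fin n → Carrier,
    (∀ i, dist (x i) (y i) < τ.funMod F r) → dist (func F x) (func F y) ≤ r
  rel_unif : ∀ {n : ℕ} (R : τ.Rel n) (r : ℚ), 0 < r → r ≤ 1 → ∀ x y : Fin n → Carrier,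
    (∀ i, dist (x i) (y i) < τ.relMod R r) → |rel R x - rel R y| ≤ r

attribute [instance] CStructure.metric CStructure.complete CStructure.nonempty

instance (τ : CLanguage.{u}) : CoeSort (CStructure τ) (Type u) := ⟨CStructure.Carrier⟩

instance CStructure.funStructure {τ : CLanguage.{u}} (M : CStructure τ) :
    τ.funLang.Structure M where
  funMap := fun F x => M.func F x
  RelMap := fun R _ => R.elim

/-- The value `φ^M(x)`. -/
noncomputable def CFormula.val {τ : CLanguage.{u}} (M : CStructure τ) :
    {n : ℕ} → CFormula τ n → (Fin n → M) → ℝ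
  | _, .dist s t, x => Dist.dist (s.realize x : M) (t.realize x)
  | _, .rel R ts, x => M.rel R (fun i => (ts i).realize x)
  | _, .zero, _ => 0
  | _, .one, _ => 1
  | _, .half φ, x => φ.val M x / 2
  | _, .monus φ ψ, x => max (φ.val M x - ψ.val M x) 0
  | n, .sup φ, x => ⨆ a : M, φ.val M (Fin.snoc x a : Fin (n + 1) → M)
  | n, .inf φ, x => ⨅ a : M, φ.val M (Fin.snoc x a : Fin (n + 1) → M)

/-- A continuous theory: a set of closed conditions `φ = 0`, given by the sentences `φ`. -/
abbrev CTheory (τ : CLanguage.{u}) := Set (CFormula τ 0)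

/-- `M` is a model of `T`. -/
def CModels {τ : CLanguage.{u}} (M : CStructure τ) (T : CTheory τ) : Prop :=
  ∀ φ ∈ T, φ.val M Fin.elim0 = 0

/-- A theory is complete if it has a model and all its models give the same value to each
sentence. -/
def CTheory.IsComplete {τ : CLanguage.{u}} (T : CTheory τ) : Prop :=
  (∃ M : CStructure τ, CModels M T) ∧
    ∀ M N : CStructure τ, CModels M T → CModels N T →
      ∀ φ : CFormula τ 0, φ.val M Fin.elim0 = φ.val N Fin.elim0

/-- Elementary embeddings of continuous structures. -/
def IsElementary {τ : CLanguage.{u}} {M N : CStructure τ} (h : M → N) : Prop :=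
  ∀ (n : ℕ) (φ : CFormula τ n) (x : Fin n → M), φ.val N (h ∘ x) = φ.val M x

/-- Conditions `φ(x) = 0` with free variables from `X`: a formula `φ` in `n` variables and the
elements of `X` that take their places. -/
abbrev CCondition (τ : CLanguage.{u}) (X : Type v) := Σ n : ℕ, CFormula τ n × (Fin n → X)

/-- The complete type of the tuple `a` in `N` over the parameters `b`: the set of all conditions
with variables from `ι` and parameters from `B` that are true of `a`. -/
def typeOf {τ : CLanguage.{u}} {ι : Type v} {B : Type w} (N : CStructure τ) (b : B → N)
    (a : ι → N) : Set (CCondition τ (ι ⊕ B)) :=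
  {c | c.2.1.val N (Sum.elim a b ∘ c.2.2) = 0}

/-- The set of complete types in the variables `ι` over a set `B` of parameters of `M`: the types
of tuples in models `N` of the theory of `(M, b)_{b ∈ B}`. -/
def TypeSpace {τ : CLanguage.{u}} (M : CStructure τ) (B : Set M) (ι : Type v) :
    Set (Set (CCondition τ (ι ⊕ B))) :=
  {p | ∃ (N : CStructure τ) (b : B → N) (a : ι → N),
    (∀ (n : ℕ) (φ : CFormula τ n) (x : Fin n → B),
      φ.val N (b ∘ x) = φ.val M (fun i => (x i : M))) ∧ p = typeOf N b a}

/-! ## The discrete language and theory of a continuous language -/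

/-- The rational numbers in `[0, 1]`. -/
abbrev QUnit := Icc (0 : ℚ) 1

/-- The relation symbols `R_{φ ≥ r}` and `R_{φ ≤ r}`. -/
inductive PlusRel (τ : CLanguage.{u}) (n : ℕ) : Type u
  | ge (φ : CFormula τ n) (r : QUnit) : PlusRel τ n
  | le (φ : CFormula τ n) (r : QUnit) : PlusRel τ n

/-- The discrete language `τ⁺`. -/
def CLanguage.plus (τ : CLanguage.{u}) : FirstOrder.Language.{u, u} := ⟨τ.Func, PlusRel τ⟩

/-- The terms of `τ` are terms of `τ⁺`. -/
def CLanguage.toPlus (τ : CLanguage.{u}) : τ.funLang →ᴸ τ.plus where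
  onFunction := fun _ F => F
  onRelation := fun _ R => R.elim

section Theory

variable {τ : CLanguage.{u}} {k n : ℕ}

/-- `R_{φ ≥ q}(ts)`; true for `q < 0` and false for `q > 1`. -/
def geF (φ : CFormula τ k) (q : ℚ) (ts : Fin k → τ.plus.Term (Fin n)) : InfFormula τ.plus n :=
  if h : q ∈ Icc (0 : ℚ) 1 then .rel (L := τ.plus) (PlusRel.ge φ ⟨q, h⟩) ts
  else if q < 0 then .tru else .fls

/-- `R_{φ ≤ q}(ts)`; true for `q > 1` and false for `q < 0`. -/
def leF (φ : CFormula τ k) (q : ℚ) (ts : Fin k → τ.plus.Term (Fin n)) : InfFormula τ.plus n :=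
  if h : q ∈ Icc (0 : ℚ) 1 then .rel (L := τ.plus) (PlusRel.le φ ⟨q, h⟩) ts
  else if q < 0 then .fls else .tru

/-- The tuple of variables `x_0, …, x_{n-1}`. -/
def vars : Fin n → τ.plus.Term (Fin n) := fun i => .var i

/-- The formula `d(y, y')`. -/
def dF : CFormula τ 2 := .dist (.var 0) (.var 1)

/-- The formula `R(z) ∸ R(z')` for disjoint tuples `z`, `z'`. -/
def diffF (R : τ.Rel n) : CFormula τ (n + n) :=
  .monus (.rel R (fun i => .var (Fin.castAdd n i))) (.rel R (fun i => .var (Fin.natAdd n i)))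

/-- The first half of `2 n` variables. -/
def varsL : Fin n → τ.plus.Term (Fin (n + n)) := fun i => .var (Fin.castAdd n i)

/-- The second half of `2 n` variables. -/
def varsR : Fin n → τ.plus.Term (Fin (n + n)) := fun i => .var (Fin.natAdd n i)

end Theory

/-- The axioms of `T_dense`, before universal closure. -/
inductive DenseAxiom (τ : CLanguage.{u}) : {n : ℕ} → InfFormula τ.plus n → Prop
  -- The ordered structure of the reals.
  | le_of_not_ge {n : ℕ} (φ : CFormula τ n) (r : QUnit) :
      DenseAxiom τ (.imp (.neg (geF φ r vars)) (leF φ r vars))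
  | ge_of_not_le {n : ℕ} (φ : CFormula τ n) (r : QUnit) :
      DenseAxiom τ (.imp (.neg (leF φ r vars)) (geF φ r vars))
  | order {n : ℕ} (φ : CFormula τ n) (r s : QUnit) (h : s < r) :
      DenseAxiom τ (.or (.neg (geF φ r vars)) (.neg (leF φ s vars)))
  | le_mono {n : ℕ} (φ : CFormula τ n) (r s : QUnit) (h : s ≤ r) :
      DenseAxiom τ (.imp (leF φ s vars) (leF φ r vars))
  | ge_mono {n : ℕ} (φ : CFormula τ n) (r s : QUnit) (h : s ≤ r) :
      DenseAxiom τ (.imp (geF φ r vars) (geF φ s vars))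
  | total {n : ℕ} (φ : CFormula τ n) (r : QUnit) :
      DenseAxiom τ (.or (geF φ r vars) (leF φ r vars))
  | approx {n : ℕ} (φ : CFormula τ n) :
      DenseAxiom τ (.iAnd fun m : ℕ =>
        .iOr fun p : {p : QUnit × QUnit // |(p.1 : ℚ) - p.2| < 1 / (m + 1)} =>
          .and (leF φ p.1.1 vars) (geF φ p.1.2 vars))
  | ge_limit {n : ℕ} (φ : CFormula τ n) (r : QUnit) :
      DenseAxiom τ (.imp (.iAnd fun m : ℕ => geF φ (r - 1 / (m + 1)) vars) (geF φ r vars))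
  | le_limit {n : ℕ} (φ : CFormula τ n) (r : QUnit) :
      DenseAxiom τ (.imp (.iAnd fun m : ℕ => leF φ (r + 1 / (m + 1)) vars) (leF φ r vars))
  -- The construction of formulas.
  | bounds {n : ℕ} (φ : CFormula τ n) :
      DenseAxiom τ (.and (geF φ 0 vars) (leF φ 1 vars))
  | consts {n : ℕ} (t : QUnit) (h : 0 < t) :
      DenseAxiom τ (.and (.neg (geF (.zero : CFormula τ n) t vars))
        (.neg (leF (.one : CFormula τ n) (1 - t) vars)))
  | half_ge {n : ℕ} (φ : CFormula τ n) (r : QUnit) :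
      DenseAxiom τ (.iff (geF (.half φ) r vars) (geF φ (2 * r) vars))
  | half_le {n : ℕ} (φ : CFormula τ n) (r : QUnit) :
      DenseAxiom τ (.iff (leF (.half φ) r vars) (leF φ (2 * r) vars))
  | monus_ge {n : ℕ} (φ ψ : CFormula τ n) (r : QUnit) (h : 0 < r) :
      DenseAxiom τ (.iff (geF (.monus φ ψ) r vars) (.iAnd fun m : ℕ =>
        .iOr fun s : QUnit => .and (leF ψ s vars) (geF φ (r + s - 1 / (m + 1)) vars)))
  | monus_le {n : ℕ} (φ ψ : CFormula τ n) (r : QUnit) :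
      DenseAxiom τ (.iff (leF (.monus φ ψ) r vars) (.iAnd fun m : ℕ =>
        .iOr fun s : QUnit => .and (geF ψ s vars) (leF φ (r + s + 1 / (m + 1)) vars)))
  | sup_le {n : ℕ} (φ : CFormula τ (n + 1)) (r : QUnit) :
      DenseAxiom τ (.iff (leF (.sup φ) r vars) (.all (leF φ r vars)))
  | sup_ge {n : ℕ} (φ : CFormula τ (n + 1)) (r : QUnit) :
      DenseAxiom τ (.iff (geF (.sup φ) r vars)
        (.iAnd fun m : ℕ => .ex (geF φ (r - 1 / (m + 1)) vars)))
  | inf_le {n : ℕ} (φ : CFormula τ (n + 1)) (r : QUnit) :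
      DenseAxiom τ (.iff (leF (.inf φ) r vars)
        (.iAnd fun m : ℕ => .ex (leF φ (r + 1 / (m + 1)) vars)))
  | inf_ge {n : ℕ} (φ : CFormula τ (n + 1)) (r : QUnit) :
      DenseAxiom τ (.iff (geF (.inf φ) r vars) (.all (geF φ r vars)))
  | subst_ge {k n : ℕ} (φ : CFormula τ k) (t : Fin k → τ.funLang.Term (Fin n)) (r : QUnit) :
      DenseAxiom τ (.iff (geF φ r (fun i => τ.toPlus.onTerm (t i))) (geF (φ.subst t) r vars))
  | subst_le {k n : ℕ} (φ : CFormula τ k) (t : Fin k → τ.funLang.Term (Fin n)) (r : QUnit) :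
      DenseAxiom τ (.iff (leF φ r (fun i => τ.toPlus.onTerm (t i))) (leF (φ.subst t) r vars))
  -- The metric structure.
  | dist_zero :
      DenseAxiom τ (n := 2) (.iff (leF dF 0 vars) (.equal (.var 0) (.var 1)))
  | dist_comm_ge (r : QUnit) :
      DenseAxiom τ (n := 2) (.iff (geF dF r ![.var 0, .var 1]) (geF dF r ![.var 1, .var 0]))
  | dist_comm_le (r : QUnit) :
      DenseAxiom τ (n := 2) (.iff (leF dF r ![.var 0, .var 1]) (leF dF r ![.var 1, .var 0]))
  | dist_triangle (r : QUnit) :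
      DenseAxiom τ (n := 2) (.imp (geF dF r ![.var 0, .var 1])
        (.all (.iAnd fun m : ℕ => .iOr fun s : {s : QUnit // s ≤ r} =>
          .and (geF dF s.1 ![.var 0, .var 2]) (geF dF (r - s.1 - 1 / (m + 1)) ![.var 2, .var 1]))))
  -- Uniform continuity.
  | func_unif {n : ℕ} (F : τ.Func n) (r s : QUnit) (hr : 0 < r)
      (hs : ((s : ℚ) : ℝ) < τ.funMod F r) :
      DenseAxiom τ (.imp (.iAnd fun i : Fin n => leF dF s ![varsL i, varsR i])
        (leF dF r ![.func (L := τ.plus) F varsL, .func (L := τ.plus) F varsR]))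
  | rel_unif {n : ℕ} (R : τ.Rel n) (r s : QUnit) (hr : 0 < r)
      (hs : ((s : ℚ) : ℝ) < τ.relMod R r) :
      DenseAxiom τ (.imp (.iAnd fun i : Fin n => leF dF s ![varsL i, varsR i])
        (.and (leF (diffF R) r (Fin.append varsL varsR))
          (leF (diffF R) r (Fin.append varsR varsL))))

/-- The theory `T_dense`. -/
def TDense (τ : CLanguage.{u}) : Set (InfFormula τ.plus 0) :=
  {σ | ∃ (n : ℕ) (φ : InfFormula τ.plus n), DenseAxiom τ φ ∧ σ = φ.alls}

/-- The theory `T* = T_dense ∪ {R_{φ ≤ 0} : φ = 0 in T}`. -/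
def TStar {τ : CLanguage.{u}} (T : CTheory τ) : Set (InfFormula τ.plus 0) :=
  TDense τ ∪ {σ | ∃ φ ∈ T, σ = leF φ 0 vars}

/-! ## From continuous to discrete structures and back -/

/-- Nicely dense subsets: dense and closed under the functions. -/
def NicelyDense {τ : CLanguage.{u}} (M : CStructure τ) (S : Set M) : Prop :=
  Dense S ∧ ∀ {n : ℕ} (F : τ.Func n) (x : Fin n → M), (∀ i, x i ∈ S) → M.func F x ∈ S

/-- The discrete `τ⁺`-structure `M_S` on a nicely dense subset `S` of `M`. -/
@[reducible] def discretization {τ : CLanguage.{u}} (M : CStructure τ) (S : Set M) (hS : NicelyDense M S) :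
    τ.plus.Structure S where
  funMap := fun F x => ⟨M.func F (fun i => (x i : M)), hS.2 F _ (fun i => (x i).2)⟩
  RelMap := fun R x => match R with
    | PlusRel.ge φ r => ((r : ℚ) : ℝ) ≤ φ.val M (fun i => (x i : M))
    | PlusRel.le φ r => φ.val M (fun i => (x i : M)) ≤ ((r : ℚ) : ℝ)

/-- `M` is, by way of `i`, the completion of the `τ⁺`-structure `A`: the map `i` identifies `A`
with the structure `M_S` on a nicely dense subset `S` of `M`, its image. -/
def IsCompletion {τ : CLanguage.{u}} (A : Type u) [τ.plus.Structure A] (M : CStructure τ)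
    (i : A → M) : Prop :=
  ∃ (S : Set M) (hS : NicelyDense M S),
    letI : τ.plus.Structure S := discretization M S hS
    ∃ e : A ≃[τ.plus] S, ∀ a : A, i a = (e a : M)

/-! ## Abstract Elementary Classes -/

/-- A class of `L`-structures together with a relation "`S` is a strong submodel of `N`" between
structures `N` and their substructures `S`. -/
structure AbstractClass (L : FirstOrder.Language.{u, u}) where
  Mem : ∀ (M : Type u) [L.Structure M], Prop
  Strong : ∀ (N : Type u) [L.Structure N], L.Substructure N → Prop

namespace AbstractClass

variable {L : FirstOrder.Language.{u, u}} (K : AbstractClass.{u} L)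

/-- A `K`-embedding: an embedding onto a strong submodel. -/
def IsStrongEmbedding {M N : Type u} [L.Structure M] [L.Structure N] (f : M ↪[L] N) : Prop :=
  K.Mem M ∧ K.Strong N f.toHom.range

/-- Abstract Elementary Classes. For substructures `R ≤ S` of `N`, the substructure
`R.comap S.subtype.toHom` of `S` is `R` itself, seen as a substructure of `S`. -/
structure IsAEC : Prop where
  mem_of_equiv : ∀ (M N : Type u) [L.Structure M] [L.Structure N], (M ≃[L] N) →
    K.Mem M → K.Mem N
  strong_of_equiv : ∀ (M N : Type u) [L.Structure M] [L.Structure N] (e : M ≃[L] N)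
    (S : L.Substructure M), K.Strong M S → K.Strong N (S.map e.toHom)
  mem_of_strong : ∀ (N : Type u) [L.Structure N] (S : L.Substructure N),
    K.Strong N S → K.Mem S ∧ K.Mem N
  refl : ∀ (N : Type u) [L.Structure N], K.Mem N → K.Strong N ⊤
  trans : ∀ (N : Type u) [L.Structure N] (S : L.Substructure N) (R : L.Substructure S),
    K.Strong S R → K.Strong N S → K.Strong N (R.map S.subtype.toHom)
  coherence : ∀ (N : Type u) [L.Structure N] (R S : L.Substructure N), R ≤ S →
    K.Strong N R → K.Strong N S → K.Strong S (R.comap S.subtype.toHom)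
  /-- Unions of chains: if `N` is the union of an increasing chain of members of `K`, each strong
  in the later ones, then `N` is in `K` and each member of the chain is strong in `N`. -/
  chain : ∀ (I : Type u) [LinearOrder I] [WellFoundedLT I] [Nonempty I] (N : Type u)
    [L.Structure N] (S : I → L.Substructure N), Monotone S → (∀ x : N, ∃ i, x ∈ S i) →
    (∀ i, K.Mem (S i)) →
    (∀ i j, i ≤ j → K.Strong (S j) ((S i).comap (S j).subtype.toHom)) →
    K.Mem N ∧ ∀ i, K.Strong N (S i)
  /-- Smoothness: if moreover all members of the chain are strong in `M`, so is their union. -/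
  smooth : ∀ (I : Type u) [LinearOrder I] [WellFoundedLT I] [Nonempty I] (M : Type u)
    [L.Structure M] (S : I → L.Substructure M) (U : L.Substructure M), Monotone S →
    (∀ x : M, x ∈ U ↔ ∃ i, x ∈ S i) →
    (∀ i j, i ≤ j → K.Strong (S j) ((S i).comap (S j).subtype.toHom)) →
    (∀ i, K.Strong M (S i)) → K.Strong M U
  /-- The Löwenheim–Skolem–Tarski axiom. -/
  lowenheim_skolem : ∃ μ : Cardinal.{u}, Cardinal.aleph0 ≤ μ ∧ L.card ≤ μ ∧
    ∀ (M : Type u) [L.Structure M], K.Mem M → ∀ A : Set M,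
      ∃ S : L.Substructure M, A ⊆ S ∧ K.Strong M S ∧ Cardinal.mk S ≤ Cardinal.mk A + μ

/-- Amalgamation over sets: two members of `K` can be amalgamated over any set `A` that has the
same quantifier-free type in both. -/
def AmalgamationOverSets : Prop :=
  ∀ (M₁ M₂ : Type u) [L.Structure M₁] [L.Structure M₂], K.Mem M₁ → K.Mem M₂ →
    ∀ (A : Type u) (e₁ : A → M₁) (e₂ : A → M₂),
      (∀ φ : L.Formula A, φ.IsQF → (φ.Realize e₁ ↔ φ.Realize e₂)) →
      ∃ (N : Type u) (_ : L.Structure N) (f₁ : M₁ ↪[L] N) (f₂ : M₂ ↪[L] N),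
        K.IsStrongEmbedding f₁ ∧ K.IsStrongEmbedding f₂ ∧ ∀ a, f₁ (e₁ a) = f₂ (e₂ a)

def JointEmbedding : Prop :=
  ∀ (M₁ M₂ : Type u) [L.Structure M₁] [L.Structure M₂], K.Mem M₁ → K.Mem M₂ →
    ∃ (N : Type u) (_ : L.Structure N) (f₁ : M₁ ↪[L] N) (f₂ : M₂ ↪[L] N),
      K.IsStrongEmbedding f₁ ∧ K.IsStrongEmbedding f₂

def NoMaximalModels : Prop :=
  ∀ (M : Type u) [L.Structure M], K.Mem M →
    ∃ (N : Type u) (_ : L.Structure N) (f : M ↪[L] N),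
      K.IsStrongEmbedding f ∧ ¬ Function.Surjective f

/-- A tuple in a strong extension `N` of `M`. -/
structure GaloisTriple (M : Type u) [L.Structure M] (ι : Type v) where
  N : Type u
  [str : L.Structure N]
  f : M ↪[L] N
  strong : K.IsStrongEmbedding f
  a : ι → N

attribute [instance] GaloisTriple.str

/-- The atomic relation of having the same Galois type over `C ⊆ M`: the two extensions can be
amalgamated over `C` so that the tuples are identified. -/
def AtomicEq {M : Type u} [L.Structure M] (C : Set M) (ι : Type v)
    (t₁ t₂ : K.GaloisTriple M ι) : Prop :=
  ∃ (N : Type u) (_ : L.Structure N) (g₁ : t₁.N ↪[L] N) (g₂ : t₂.N ↪[L] N),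
    K.IsStrongEmbedding g₁ ∧ K.IsStrongEmbedding g₂ ∧
      (∀ c ∈ C, g₁ (t₁.f c) = g₂ (t₂.f c)) ∧ ∀ i, g₁ (t₁.a i) = g₂ (t₂.a i)

/-- Galois types over `C ⊆ M` of tuples indexed by `ι`: the classes of the equivalence relation
that the atomic relation generates. -/
def GaloisType {M : Type u} [L.Structure M] (C : Set M) (ι : Type v) :=
  Quot (K.AtomicEq C ι)

/-- The Galois type of a tuple. -/
def gtp {M : Type u} [L.Structure M] (C : Set M) {ι : Type v} (t : K.GaloisTriple M ι) :
    K.GaloisType C ι :=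
  Quot.mk _ t

end AbstractClass

/-- The class of models of an infinitary theory, ordered by the substructure relation. -/
def modClass {L : FirstOrder.Language.{u, u}} (T : Set (InfFormula L 0)) : AbstractClass.{u} L where
  Mem := fun M _ => Nonempty M ∧ InfModels M T
  Strong := fun N _ S => (Nonempty S ∧ InfModels S T) ∧ (Nonempty N ∧ InfModels N T)

end ContLogic

open ContLogic

namespace ContLogic

/-! ## Infinitary formulas -/

/-! A model of `TDense τ` is a set `A` on which every continuous formula has a real value, subject
to the recursive clauses for truth (with sup and inf taken over `A`), a metric and the moduli. The
relations of `τ⁺` are the rational cuts of these values, and `pval` recovers the values from the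
cuts. `IsPlusVal.infModels` and `InfModels.isPlusVal` are the two directions of this dictionary. The
separated completion of such an `A` is a continuous structure. A sup or inf of a continuous function
is the same over a dense subset, so induction on formulas shows that truth in the completion is the
given valuation (`IsVal.exists_completion`). Hence the members of `K` are, up to isomorphism, the
structures `M_S` with `M ⊨ T`.

Since `τ⁺` names every formula, its embeddings preserve all values and extend to elementary maps of
the completions. Conversely, elementary maps that respect the dense subsets restrict to embeddings.
The strong submodels are therefore just the submodels that lie in `K`, and the AEC axioms need only
two facts: the clauses of a valuation can be checked on finite tuples (`isPlusVal_of_local`, for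
unions of chains), and they pass to a substructure by a Tarski–Vaught test for single relations
(`isPlusVal_of_embedding`, for Löwenheim–Skolem).

The other parts rest on elementary amalgamation over a common set of parameters
(`exists_elementary_amalgam`): approximate finite maps from `M₁` to `M₂` are glued in an ultrapower
of `M₂`. Over a set with equal quantifier-free types this gives amalgamation, over the empty set
joint embedding, and over a realized type and its parameters the correspondence of types. Elementary
maps that agree on `C` agree on its closure, so the parameters may be any set between `C` and its
closure. -/

theorem InfFormula.realize_alls {L : FirstOrder.Language.{u, u}} {M : Type w} [L.Structure M] :
    ∀ {n : ℕ} (φ : InfFormula L n), φ.alls.Realize (M := M) Fin.elim0 ↔ ∀ x : Fin n → M, φ.Realize x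
  | 0, φ => by
      refine ⟨fun h x => ?_, fun h => h _⟩
      rwa [Subsingleton.elim x Fin.elim0]
  | n + 1, φ => by
      rw [alls, realize_alls (all φ)]
      refine ⟨fun h x => ?_, fun h x a => h _⟩
      have := h (Fin.init x) (x (Fin.last n))
      rwa [Fin.snoc_init_self] at this

section Connectives

variable {L : FirstOrder.Language.{u, u}} {M : Type w} [L.Structure M] {n : ℕ}
  (φ ψ : InfFormula L n) (x : Fin n → M)

theorem InfFormula.realize_fls : (fls : InfFormula L n).Realize x ↔ False :=
  ⟨fun ⟨i, _⟩ => i.elim, False.elim⟩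

theorem InfFormula.realize_neg : (neg φ).Realize x ↔ ¬ φ.Realize x := Iff.rfl

theorem InfFormula.realize_iAnd {ι : Type} [Countable ι] (φ : ι → InfFormula L n) :
    (iAnd φ).Realize x ↔ ∀ i, (φ i).Realize x := Iff.rfl

theorem InfFormula.realize_iOr {ι : Type} [Countable ι] (φ : ι → InfFormula L n) :
    (iOr φ).Realize x ↔ ∃ i, (φ i).Realize x := Iff.rfl

theorem InfFormula.realize_all (φ : InfFormula L (n + 1)) :
    (all φ).Realize x ↔ ∀ a : M, φ.Realize (Fin.snoc x a : Fin (n + 1) → M) := Iff.rfl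

theorem InfFormula.realize_ex (φ : InfFormula L (n + 1)) :
    (ex φ).Realize x ↔ ∃ a : M, φ.Realize (Fin.snoc x a : Fin (n + 1) → M) := Iff.rfl

theorem InfFormula.realize_and : (and φ ψ).Realize x ↔ φ.Realize x ∧ ψ.Realize x :=
  ⟨fun h => ⟨h true, h false⟩, fun h b => by cases b; exacts [h.2, h.1]⟩

theorem InfFormula.realize_or : (or φ ψ).Realize x ↔ φ.Realize x ∨ ψ.Realize x :=
  ⟨fun ⟨b, h⟩ => by cases b; exacts [.inr h, .inl h],
    fun h => h.elim (fun h => ⟨true, h⟩) (fun h => ⟨false, h⟩)⟩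

theorem InfFormula.realize_imp : (imp φ ψ).Realize x ↔ (φ.Realize x → ψ.Realize x) := by
  rw [imp, realize_or, realize_neg, imp_iff_not_or]

theorem InfFormula.realize_iff : (iff φ ψ).Realize x ↔ (φ.Realize x ↔ ψ.Realize x) := by
  rw [iff, realize_and, realize_imp, realize_imp]
  exact iff_def.symm

end Connectives

theorem InfFormula.realize_equiv {L : FirstOrder.Language.{u, u}} {M N : Type w} [L.Structure M]
    [L.Structure N] (e : M ≃[L] N) {n : ℕ} (φ : InfFormula L n) (x : Fin n → M) :
    φ.Realize (e ∘ x) ↔ φ.Realize x := by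
  induction φ with
  | equal s t =>
    simp only [Realize, HomClass.realize_term]
    exact e.injective.eq_iff
  | rel R ts =>
    simp only [Realize, HomClass.realize_term]
    exact e.map_rel R _
  | neg φ ih => simp only [Realize, ih]
  | iAnd φ ih => simp only [Realize, ih]
  | iOr φ ih => simp only [Realize, ih]
  | all φ ih =>
    simp only [Realize, ← ih, Fin.comp_snoc]
    exact e.surjective.forall
  | ex φ ih =>
    simp only [Realize, ← ih, Fin.comp_snoc]
    exact e.surjective.exists

theorem InfModels.of_equiv {L : FirstOrder.Language.{u, u}} {M N : Type w} [L.Structure M]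
    [L.Structure N] (e : M ≃[L] N) {T : Set (InfFormula L 0)} (h : InfModels M T) :
    InfModels N T := fun σ hσ => by
  have := (σ.realize_equiv e Fin.elim0).2 (h σ hσ)
  rwa [Subsingleton.elim (e ∘ Fin.elim0) Fin.elim0] at this

/-! ## Rational approximation in the unit interval -/

/-- The interval may meet the unit interval in the single point 0 or 1, as happens for values at the
ends. The bounds on `s` are therefore not strict. -/
theorem exists_qunit_between {a b : ℝ} (h : a < b) (ha : a ≤ 1) (hb : 0 ≤ b) :
    ∃ s : QUnit, a ≤ ((s : ℚ) : ℝ) ∧ ((s : ℚ) : ℝ) ≤ b := by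
  rcases ha.eq_or_lt with rfl | ha
  · exact ⟨⟨1, by simp⟩, by simp, by simpa using h.le⟩
  rcases hb.eq_or_lt with rfl | hb
  · exact ⟨⟨0, by simp⟩, by simpa using h.le, by simp⟩
  obtain ⟨q, h1, h2⟩ := exists_rat_btwn (show max a 0 < min b 1 by simp [*])
  rw [max_lt_iff] at h1
  rw [lt_min_iff] at h2
  exact ⟨⟨q, by exact_mod_cast h1.2.le, by exact_mod_cast h2.2.le⟩, h1.1.le, h2.1.le⟩

/-- Upper rational cuts alone determine a number. In verifying the equations of a valuation, only
the `≤` half of each pair of axioms is then needed. -/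
theorem eq_of_forall_qunit {a b : ℝ} (ha : a ∈ Icc (0 : ℝ) 1) (hb : b ∈ Icc (0 : ℝ) 1)
    (h : ∀ r : QUnit, a ≤ ((r : ℚ) : ℝ) ↔ b ≤ ((r : ℚ) : ℝ)) : a = b := by
  refine le_antisymm (le_of_forall_gt_imp_ge_of_dense fun c hc => ?_)
    (le_of_forall_gt_imp_ge_of_dense fun c hc => ?_)
  · obtain ⟨s, h1, h2⟩ := exists_qunit_between hc hb.2 (hb.1.trans hc.le)
    exact ((h s).2 h1).trans h2
  · obtain ⟨s, h1, h2⟩ := exists_qunit_between hc ha.2 (ha.1.trans hc.le)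
    exact ((h s).1 h1).trans h2

theorem le_of_forall_sub_nat {a b : ℝ} (h : ∀ m : ℕ, a - 1 / (m + 1) ≤ b) : a ≤ b :=
  le_of_forall_pos_le_add fun ε hε => by
    obtain ⟨m, hm⟩ := exists_nat_one_div_lt hε
    linarith [h m]

/-! ## Valuations -/

/-- An assignment of real values to all continuous formulas at all tuples from `A`. -/
abbrev Valuation (τ : CLanguage.{u}) (A : Type w) := ∀ n : ℕ, CFormula τ n → (Fin n → A) → ℝ

/-- The valuation obeys the recursive definition of truth values, and its distance is a
pseudometric for which the symbols of `τ` obey their moduli of uniform continuity. -/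
structure IsVal {τ : CLanguage.{u}} {A : Type w} [τ.funLang.Structure A] (v : Valuation τ A) :
    Prop where
  mem : ∀ {n} (φ : CFormula τ n) x, v n φ x ∈ Icc (0 : ℝ) 1
  zero : ∀ {n} x, v n .zero x = 0
  one : ∀ {n} x, v n .one x = 1
  half : ∀ {n} (φ : CFormula τ n) x, v n (.half φ) x = v n φ x / 2
  monus : ∀ {n} (φ ψ : CFormula τ n) x, v n (.monus φ ψ) x = max (v n φ x - v n ψ x) 0
  sup : ∀ {n} (φ : CFormula τ (n + 1)) (x : Fin n → A),
    IsLUB (range fun a : A => v (n + 1) φ (Fin.snoc x a : Fin (n + 1) → A)) (v n (.sup φ) x)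
  inf : ∀ {n} (φ : CFormula τ (n + 1)) (x : Fin n → A),
    IsGLB (range fun a : A => v (n + 1) φ (Fin.snoc x a : Fin (n + 1) → A)) (v n (.inf φ) x)
  subst : ∀ {k n} (φ : CFormula τ k) (t : Fin k → τ.funLang.Term (Fin n)) (x : Fin n → A),
    v n (φ.subst t) x = v k φ (fun i => (t i).realize x)
  dist_self : ∀ a : A, v 2 dF ![a, a] = 0
  dist_comm : ∀ a b : A, v 2 dF ![a, b] = v 2 dF ![b, a]
  dist_triangle : ∀ a b c : A, v 2 dF ![a, c] ≤ v 2 dF ![a, b] + v 2 dF ![b, c]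
  func_unif : ∀ {n} (F : τ.Func n) (r : ℚ), 0 < r → r ≤ 1 → ∀ x y : Fin n → A,
    (∀ i, v 2 dF ![x i, y i] < τ.funMod F r) →
      v 2 dF ![Structure.funMap (L := τ.funLang) F x, Structure.funMap (L := τ.funLang) F y] ≤ r
  rel_unif : ∀ {n} (R : τ.Rel n) (r : ℚ), 0 < r → r ≤ 1 → ∀ x y : Fin n → A,
    (∀ i, v 2 dF ![x i, y i] < τ.relMod R r) →
      |v n (.rel R .var) x - v n (.rel R .var) y| ≤ r

namespace IsVal

variable {τ : CLanguage.{u}} {A : Type w} [τ.funLang.Structure A] {v : Valuation τ A}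

theorem dist (h : IsVal v) {n : ℕ} (s t : τ.funLang.Term (Fin n)) (x : Fin n → A) :
    v n (.dist s t) x = v 2 dF ![s.realize x, t.realize x] := by
  have := h.subst dF ![s, t] x
  simp only [dF, CFormula.subst, Term.subst, Matrix.cons_val_zero, Matrix.cons_val_one] at this
  rw [this]
  congr 1
  ext i
  fin_cases i <;> rfl

/-- An atomic formula is a substitution instance of one whose arguments are distinct variables, so
the substitution clause fixes its value. -/
theorem rel (h : IsVal v) {n l : ℕ} (R : τ.Rel l) (ts : Fin l → τ.funLang.Term (Fin n))
    (x : Fin n → A) : v n (.rel R ts) x = v l (.rel R .var) (fun i => (ts i).realize x) := by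
  rw [← h.subst]
  rfl

end IsVal

/-! ## Structures for the discrete language -/

instance plusFunStructure (τ : CLanguage.{u}) (A : Type w) [τ.plus.Structure A] :
    τ.funLang.Structure A := τ.toPlus.reduct A

/-- The relations of the `τ⁺`-structure `A` compare the values of a valuation with rational
numbers, and the metric separates points. -/
structure IsPlusVal {τ : CLanguage.{u}} (A : Type w) [τ.plus.Structure A] (v : Valuation τ A) :
    Prop extends IsVal v where
  ge : ∀ {n} (φ : CFormula τ n) (r : QUnit) x,
    Structure.RelMap (L := τ.plus) (PlusRel.ge φ r) x ↔ ((r : ℚ) : ℝ) ≤ v n φ x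
  le : ∀ {n} (φ : CFormula τ n) (r : QUnit) x,
    Structure.RelMap (L := τ.plus) (PlusRel.le φ r) x ↔ v n φ x ≤ ((r : ℚ) : ℝ)
  sep : ∀ a b : A, v 2 dF ![a, b] = 0 → a = b

/-- The valuation that the relations of a `τ⁺`-structure describe. -/
noncomputable def pval {τ : CLanguage.{u}} (A : Type w) [τ.plus.Structure A] : Valuation τ A :=
  fun _ φ x => sSup {q : ℝ | ∃ r : QUnit, ((r : ℚ) : ℝ) = q ∧
    Structure.RelMap (L := τ.plus) (PlusRel.ge φ r) x}

section Realize

variable {τ : CLanguage.{u}} {A : Type w} [τ.plus.Structure A] {k n : ℕ}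

theorem realize_geF_of_mem (φ : CFormula τ k) (r : QUnit) (ts : Fin k → τ.plus.Term (Fin n))
    (x : Fin n → A) : (geF φ r ts).Realize x ↔
      Structure.RelMap (L := τ.plus) (PlusRel.ge φ r) (fun i => (ts i).realize x) := by
  rw [geF, dif_pos r.2]
  rfl

theorem realize_leF_of_mem (φ : CFormula τ k) (r : QUnit) (ts : Fin k → τ.plus.Term (Fin n))
    (x : Fin n → A) : (leF φ r ts).Realize x ↔
      Structure.RelMap (L := τ.plus) (PlusRel.le φ r) (fun i => (ts i).realize x) := by
  rw [leF, dif_pos r.2]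
  rfl

theorem realize_geF_of_neg (φ : CFormula τ k) {q : ℚ} (hq : q < 0)
    (ts : Fin k → τ.plus.Term (Fin n)) (x : Fin n → A) : (geF φ q ts).Realize x := by
  rw [geF, dif_neg (fun h => h.1.not_gt hq), if_pos hq]
  exact fun i => i.elim

theorem realize_leF_of_one_lt (φ : CFormula τ k) {q : ℚ} (hq : 1 < q)
    (ts : Fin k → τ.plus.Term (Fin n)) (x : Fin n → A) : (leF φ q ts).Realize x := by
  rw [leF, dif_neg (fun h => h.2.not_gt hq), if_neg (by linarith)]
  exact fun i => i.elim

/-- The conventions for `q` outside the unit interval are the true comparisons, because values lie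
in `[0, 1]`. The two properties of `v` are separate hypotheses so that the lemma can serve while
`IsPlusVal` is still being established. -/
theorem realize_geF {v : Valuation τ A}
    (hm : ∀ {n} (φ : CFormula τ n) x, v n φ x ∈ Icc (0 : ℝ) 1)
    (hge : ∀ {n} (φ : CFormula τ n) (r : QUnit) x,
      Structure.RelMap (L := τ.plus) (PlusRel.ge φ r) x ↔ ((r : ℚ) : ℝ) ≤ v n φ x)
    (φ : CFormula τ k) (q : ℚ) (ts : Fin k → τ.plus.Term (Fin n))
    (x : Fin n → A) :
    (geF φ q ts).Realize x ↔ (q : ℝ) ≤ v k φ (fun i => (ts i).realize x) := by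
  have hm := hm φ (fun i => (ts i).realize x)
  by_cases h : q ∈ Icc (0 : ℚ) 1
  · rw [← hge φ ⟨q, h⟩, ← realize_geF_of_mem]
  · by_cases h0 : q < 0
    · have : (q : ℝ) < 0 := by exact_mod_cast h0
      simp only [realize_geF_of_neg φ h0, true_iff]
      linarith [hm.1]
    · have h1 : 1 < q := by
        by_contra h1
        exact h ⟨not_lt.1 h0, not_lt.1 h1⟩
      have : (1 : ℝ) < q := by exact_mod_cast h1
      rw [geF, dif_neg h, if_neg h0, InfFormula.realize_fls, false_iff]
      linarith [hm.2]

theorem realize_leF {v : Valuation τ A}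
    (hm : ∀ {n} (φ : CFormula τ n) x, v n φ x ∈ Icc (0 : ℝ) 1)
    (hle : ∀ {n} (φ : CFormula τ n) (r : QUnit) x,
      Structure.RelMap (L := τ.plus) (PlusRel.le φ r) x ↔ v n φ x ≤ ((r : ℚ) : ℝ))
    (φ : CFormula τ k) (q : ℚ) (ts : Fin k → τ.plus.Term (Fin n))
    (x : Fin n → A) :
    (leF φ q ts).Realize x ↔ v k φ (fun i => (ts i).realize x) ≤ (q : ℝ) := by
  have hm := hm φ (fun i => (ts i).realize x)
  by_cases h : q ∈ Icc (0 : ℚ) 1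
  · rw [← hle φ ⟨q, h⟩, ← realize_leF_of_mem]
  · by_cases h0 : q < 0
    · have : (q : ℝ) < 0 := by exact_mod_cast h0
      rw [leF, dif_neg h, if_pos h0, InfFormula.realize_fls, false_iff]
      linarith [hm.1]
    · have h1 : 1 < q := by
        by_contra h1
        exact h ⟨not_lt.1 h0, not_lt.1 h1⟩
      have : (1 : ℝ) < q := by exact_mod_cast h1
      simp only [realize_leF_of_one_lt φ h1, true_iff]
      linarith [hm.2]

end Realize

section Diff

variable {τ : CLanguage.{u}} {A : Type w} [τ.funLang.Structure A] {v : Valuation τ A}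

theorem val_diffF (hmonus : ∀ {n} (φ ψ : CFormula τ n) x,
      v n (.monus φ ψ) x = max (v n φ x - v n ψ x) 0)
    (hsubst : ∀ {k n} (φ : CFormula τ k) (t : Fin k → τ.funLang.Term (Fin n)) (x : Fin n → A),
      v n (φ.subst t) x = v k φ (fun i => (t i).realize x))
    {n : ℕ} (R : τ.Rel n) (x y : Fin n → A) :
    v (n + n) (diffF R) (Fin.append x y) =
      max (v n (.rel R .var) x - v n (.rel R .var) y) 0 := by
  rw [diffF, hmonus]
  have h1 := hsubst (.rel R .var) (fun i => .var (Fin.castAdd n i)) (Fin.append x y)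
  have h2 := hsubst (.rel R .var) (fun i => .var (Fin.natAdd n i)) (Fin.append x y)
  simp only [CFormula.subst, Term.subst, Term.realize, Fin.append_left, Fin.append_right]
    at h1 h2
  rw [h1, h2]

end Diff


/-! ### From valuations to models of `T_dense` -/

section

variable {τ : CLanguage.{u}} {A : Type w} [τ.plus.Structure A]

theorem realize_vars {n : ℕ} (x : Fin n → A) :
    (fun i => ((vars : Fin n → τ.plus.Term (Fin n)) i).realize x) = x := rfl

theorem realize_varsL {n : ℕ} (x y : Fin n → A) (i : Fin n) :
    ((varsL : Fin n → τ.plus.Term (Fin (n + n))) i).realize (Fin.append x y) = x i :=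
  Fin.append_left x y i

theorem realize_varsR {n : ℕ} (x y : Fin n → A) (i : Fin n) :
    ((varsR : Fin n → τ.plus.Term (Fin (n + n))) i).realize (Fin.append x y) = y i :=
  Fin.append_right x y i

theorem realize_append {k l n : ℕ} (s : Fin k → τ.plus.Term (Fin n))
    (t : Fin l → τ.plus.Term (Fin n)) (x : Fin n → A) :
    (fun i => (Fin.append s t i).realize x) =
      Fin.append (fun i => (s i).realize x) (fun i => (t i).realize x) := by
  ext i
  refine Fin.addCases (fun i => ?_) (fun i => ?_) i <;> simp

theorem realize_pair {n : ℕ} (s t : τ.plus.Term (Fin n)) (x : Fin n → A) :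
    (fun i => ((![s, t] : Fin 2 → _) i).realize x) = ![s.realize x, t.realize x] := by
  ext i
  fin_cases i <;> rfl

theorem realize_toPlus {n : ℕ} (t : τ.funLang.Term (Fin n)) (x : Fin n → A) :
    (τ.toPlus.onTerm t).realize x = t.realize x := by
  let := τ.toPlus.reduct A
  exact LHom.realize_onTerm _ _ _

/-- Once the relations are read as comparisons of real values, each axiom is a statement about real
numbers. The countable disjunctions over rationals hold because the slack `1 / (m + 1)` leaves room
for a rational approximation. -/
theorem IsPlusVal.infModels {v : Valuation τ A} (h : IsPlusVal A v) : InfModels A (TDense τ) := by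
  rintro σ ⟨n, φ, hφ, rfl⟩
  rw [InfFormula.realize_alls]
  intro x
  cases hφ <;>
  simp only [InfFormula.realize_imp, InfFormula.realize_or, InfFormula.realize_and,
    InfFormula.realize_iff, InfFormula.realize_neg, InfFormula.realize_all, InfFormula.realize_ex,
    InfFormula.realize_iAnd, InfFormula.realize_iOr, realize_geF h.mem h.ge,
    realize_leF h.mem h.le, realize_vars, realize_pair, realize_append, realize_toPlus,
    h.half, h.monus, h.zero, h.one, h.subst, not_le]
  case le_of_not_ge r φ => exact le_of_lt
  case ge_of_not_le r φ => exact le_of_lt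
  case order r s hrs φ =>
    have : ((s : ℚ) : ℝ) < ((r : ℚ) : ℝ) := by exact_mod_cast hrs
    by_contra! hc
    linarith
  case le_mono r s hrs φ =>
    have : ((s : ℚ) : ℝ) ≤ ((r : ℚ) : ℝ) := by exact_mod_cast hrs
    exact fun h => h.trans this
  case ge_mono r s hrs φ =>
    have : ((s : ℚ) : ℝ) ≤ ((r : ℚ) : ℝ) := by exact_mod_cast hrs
    exact fun h => this.trans h
  case total φ r => exact le_total _ _
  case approx φ =>
    intro m
    -- Rationals within a third of `1 / (m + 1)` above and below the value differ by at most two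
    -- thirds, hence strictly less than required.
    have hm : (0 : ℝ) < 1 / (m + 1) / 3 := by positivity
    obtain ⟨s, hs⟩ := exists_qunit_between (show v n φ x < v n φ x + 1 / (m + 1) / 3 by linarith)
      (h.mem φ x).2 (by linarith [(h.mem φ x).1])
    obtain ⟨t, ht⟩ := exists_qunit_between (show v n φ x - 1 / (m + 1) / 3 < v n φ x by linarith)
      (by linarith [(h.mem φ x).2]) (h.mem φ x).1
    refine ⟨⟨(s, t), ?_⟩, hs.1, ht.2⟩
    have : |((s : ℚ) : ℝ) - ((t : ℚ) : ℝ)| < 1 / (m + 1) := by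
      rw [abs_lt]
      constructor <;> linarith
    simpa only [← Rat.cast_lt (K := ℝ), Rat.cast_abs, Rat.cast_sub, Rat.cast_div, Rat.cast_one,
      Rat.cast_add, Rat.cast_natCast] using this
  case ge_limit φ r =>
    intro hr
    refine le_of_forall_sub_nat fun m => ?_
    simpa using hr m
  case le_limit φ r =>
    intro hr
    refine le_of_forall_sub_nat fun m => ?_
    have := hr m
    push_cast at this
    linarith
  case bounds φ => simpa using h.mem φ x
  case consts t ht =>
    have : (0 : ℝ) < ((t : ℚ) : ℝ) := by exact_mod_cast ht
    push_cast
    constructor <;> linarith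
  case half_ge r φ => push_cast; constructor <;> intro <;> linarith
  case half_le r φ => push_cast; constructor <;> intro <;> linarith
  case monus_ge r hr φ ψ =>
    have hr' : (0 : ℝ) < ((r : ℚ) : ℝ) := by exact_mod_cast hr
    have h1 := h.mem ψ x
    push_cast
    constructor
    · intro hr1 m
      have hm : (0 : ℝ) < 1 / (m + 1) := by positivity
      have hr1 := (le_max_iff.1 hr1).resolve_right (by linarith)
      obtain ⟨s, hs⟩ := exists_qunit_between (show v n ψ x < v n ψ x + 1 / (m + 1) by linarith)
        h1.2 (by linarith [h1.1])
      exact ⟨s, hs.1, by linarith⟩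
    · intro hr1
      refine le_max_of_le_left (le_of_forall_sub_nat fun m => ?_)
      obtain ⟨s, hs, hs2⟩ := hr1 m
      linarith
  case monus_le r φ ψ =>
    have hr : (0 : ℝ) ≤ ((r : ℚ) : ℝ) := by exact_mod_cast r.2.1
    have h1 := h.mem ψ x
    push_cast
    constructor
    · intro hr1 m
      have hm : (0 : ℝ) < 1 / (m + 1) := by positivity
      have hr1 := (max_le_iff.1 hr1).1
      obtain ⟨s, hs⟩ := exists_qunit_between (show v n ψ x - 1 / (m + 1) < v n ψ x by linarith)
        (by linarith [h1.2]) h1.1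
      exact ⟨s, hs.2, by linarith⟩
    · intro hr1
      refine max_le (le_of_forall_sub_nat fun m => ?_) hr
      obtain ⟨s, hs, hs2⟩ := hr1 m
      linarith
  case sup_le r φ =>
    rw [isLUB_le_iff (h.sup φ x)]
    simp [upperBounds]
  case sup_ge r φ =>
    have hl := h.sup φ x
    push_cast
    constructor
    · intro hr m
      have hm : (0 : ℝ) < 1 / (m + 1) := by positivity
      obtain ⟨_, ⟨a, rfl⟩, ha, -⟩ := hl.exists_between
        (show ((r : ℚ) : ℝ) - 1 / (m + 1) < v n φ.sup x by linarith)
      exact ⟨a, ha.le⟩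
    · intro hr
      refine le_of_forall_sub_nat fun m => ?_
      obtain ⟨a, ha⟩ := hr m
      exact ha.trans (hl.1 ⟨a, rfl⟩)
  case inf_le r φ =>
    have hl := h.inf φ x
    push_cast
    constructor
    · intro hr m
      have hm : (0 : ℝ) < 1 / (m + 1) := by positivity
      obtain ⟨_, ⟨a, rfl⟩, -, ha⟩ := hl.exists_between
        (show v n φ.inf x < ((r : ℚ) : ℝ) + 1 / (m + 1) by linarith)
      exact ⟨a, ha.le⟩
    · intro hr
      refine le_of_forall_sub_nat fun m => ?_
      obtain ⟨a, ha⟩ := hr m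
      linarith [hl.1 ⟨a, rfl⟩]
  case inf_ge r φ =>
    rw [le_isGLB_iff (h.inf φ x)]
    simp [lowerBounds]
  case dist_zero =>
    have hd := h.mem dF x
    have hx : x = ![x 0, x 1] := by ext i; fin_cases i <;> rfl
    change v 2 dF x ≤ _ ↔ x 0 = x 1
    rw [hx] at hd ⊢
    push_cast
    constructor
    · intro h0
      exact h.sep _ _ (le_antisymm h0 hd.1)
    · intro h0
      change x 0 = x 1 at h0
      rw [← h0, h.dist_self]
  case dist_comm_ge r => rw [h.dist_comm]
  case dist_comm_le r => rw [h.dist_comm]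
  case dist_triangle r =>
    intro hr a m
    have hr0 : (0 : ℝ) ≤ ((r : ℚ) : ℝ) := by exact_mod_cast r.2.1
    have hr1 : ((r : ℚ) : ℝ) ≤ 1 := by exact_mod_cast r.2.2
    have e0 : (Fin.snoc x a : Fin 3 → A) 0 = x 0 := rfl
    have e1 : (Fin.snoc x a : Fin 3 → A) 1 = x 1 := rfl
    have e2 : (Fin.snoc x a : Fin 3 → A) 2 = a := rfl
    simp only [Term.realize_var] at hr ⊢
    rw [e0, e1, e2]
    have ht := h.dist_triangle (x 0) a (x 1)
    have hd := h.mem dF ![x 0, a]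
    have hm : (0 : ℝ) < 1 / (m + 1) := by positivity
    -- The axiom demands `s ≤ r`, so `s` approximates the minimum of the distance and `r` from
    -- below. If the minimum is `r`, the remaining bound is at most 0; otherwise the triangle
    -- inequality gives it.
    have hmin : min (v 2 dF ![x 0, a]) ((r : ℚ) : ℝ) - 1 / (m + 1) <
      min (v 2 dF ![x 0, a]) ((r : ℚ) : ℝ) := by linarith
    obtain ⟨s, hs1, hs2⟩ := exists_qunit_between hmin
      (by linarith [min_le_left (v 2 dF ![x 0, a]) ((r : ℚ) : ℝ), hd.2]) (le_min hd.1 hr0)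
    rw [le_min_iff] at hs2
    have hd' := (h.mem dF ![a, x 1]).1
    refine ⟨⟨s, by exact_mod_cast hs2.2⟩, hs2.1, ?_⟩
    push_cast
    rcases min_cases (v 2 dF ![x 0, a]) ((r : ℚ) : ℝ) with hc | hc <;> rw [hc.1] at hs1 <;> linarith
  case func_unif k F r s hr hs =>
    obtain ⟨x, y, rfl⟩ : ∃ a b, x = Fin.append a b := ⟨_, _, (Fin.append_castAdd_natAdd).symm⟩
    simp only [realize_varsL, realize_varsR]
    intro hx
    have e1 : ∀ f : Fin k → τ.plus.Term (Fin (k + k)),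
      (Term.func (L := τ.plus) F f).realize (Fin.append x y) =
        Structure.funMap (L := τ.funLang) F (fun i => (f i).realize (Fin.append x y)) :=
      fun _ => rfl
    simp only [e1, realize_varsL, realize_varsR]
    exact h.func_unif F r hr r.2.2 _ _ fun i => (hx i).trans_lt hs
  case rel_unif k R r s hr hs =>
    obtain ⟨x, y, rfl⟩ : ∃ a b, x = Fin.append a b := ⟨_, _, (Fin.append_castAdd_natAdd).symm⟩
    simp only [realize_varsL, realize_varsR, val_diffF h.monus h.subst]
    intro hx
    have h1 := h.rel_unif R r hr r.2.2 _ _ fun i => (hx i).trans_lt hs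
    have hr0 : (0 : ℝ) ≤ ((r : ℚ) : ℝ) := by exact_mod_cast r.2.1
    rw [abs_le] at h1
    exact ⟨max_le (by linarith) hr0, max_le (by linarith) hr0⟩

end


/-! ### From models of `T_dense` to valuations -/

section

variable {τ : CLanguage.{u}} {A : Type w} [τ.plus.Structure A]

/-- The continuity axioms use one rational bound `s` below the modulus for all arguments. A finite
family of strict inequalities leaves room for one; for arity 0 the positivity of `Δ` does. -/
theorem exists_qunit_lt_of_forall_lt {n : ℕ} {f : Fin n → ℝ} (hf : ∀ i, f i ∈ Icc (0 : ℝ) 1)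
    {Δ : ℝ} (hΔ : 0 < Δ) (h : ∀ i, f i < Δ) :
    ∃ s : QUnit, (∀ i, f i ≤ ((s : ℚ) : ℝ)) ∧ ((s : ℚ) : ℝ) < Δ := by
  obtain ⟨m, hm, hmΔ, hfm⟩ : ∃ m ∈ Icc (0 : ℝ) 1, m < Δ ∧ ∀ i, f i ≤ m := by
    rcases isEmpty_or_nonempty (Fin n)
    · exact ⟨0, by simp, hΔ, fun i => isEmptyElim i⟩
    · obtain ⟨i, hi⟩ := Finite.exists_max f
      exact ⟨f i, hf i, h i, hi⟩
  obtain ⟨s, h1, h2⟩ := exists_qunit_between (show m < (m + Δ) / 2 by linarith) hm.2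
    (by linarith [hm.1])
  exact ⟨s, fun i => (hfm i).trans h1, by linarith⟩

theorem InfModels.realize_denseAxiom (h : InfModels A (TDense τ)) {n : ℕ}
    {φ : InfFormula τ.plus n} (hφ : DenseAxiom τ φ) (x : Fin n → A) : φ.Realize x :=
  InfFormula.realize_alls φ |>.1 (h _ ⟨n, φ, hφ, rfl⟩) x

theorem pval_eq {v : Valuation τ A} {n : ℕ} (φ : CFormula τ n) (x : Fin n → A)
    (hm : v n φ x ∈ Icc (0 : ℝ) 1)
    (hge : ∀ r : QUnit, Structure.RelMap (L := τ.plus) (PlusRel.ge φ r) x ↔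
      ((r : ℚ) : ℝ) ≤ v n φ x) : pval A n φ x = v n φ x := by
  refine IsLUB.csSup_eq ⟨?_, ?_⟩ ⟨_, ⟨0, by simp⟩, rfl, (hge _).2 (by simpa using hm.1)⟩
  · rintro _ ⟨r, rfl, hr⟩
    exact (hge r).1 hr
  · intro b hb
    refine le_of_forall_lt_imp_le_of_dense fun c hc => ?_
    obtain ⟨s, h1, h2⟩ := exists_qunit_between hc (hc.le.trans hm.2) hm.1
    exact h1.trans (hb ⟨s, rfl, (hge s).2 h2⟩)

theorem IsPlusVal.eq_pval {v : Valuation τ A} (h : IsPlusVal A v) : v = pval A := by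
  ext n φ x
  exact (pval_eq φ x (h.mem φ x) fun r => h.ge φ r x).symm

theorem InfModels.pval_mem (h : InfModels A (TDense τ)) {n : ℕ} (φ : CFormula τ n)
    (x : Fin n → A) : pval A n φ x ∈ Icc (0 : ℝ) 1 := by
  have hb := h.realize_denseAxiom (.bounds φ) x
  rw [InfFormula.realize_and] at hb
  have h0 := (realize_geF_of_mem φ ⟨0, by simp⟩ vars x).1 hb.1
  have hbdd : ∀ q ∈ {q : ℝ | ∃ r : QUnit, ((r : ℚ) : ℝ) = q ∧
      Structure.RelMap (L := τ.plus) (PlusRel.ge φ r) x}, q ≤ 1 := by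
    rintro _ ⟨r, rfl, -⟩
    exact_mod_cast r.2.2
  exact ⟨le_csSup ⟨1, hbdd⟩ ⟨_, by simp, h0⟩, csSup_le ⟨_, _, rfl, h0⟩ hbdd⟩

/-- If `r` is at most the supremum, each `r - 1 / (m + 1)` lies strictly below it, hence below a
member of the set. Monotonicity and the limit axiom then give the relation at `r` itself. -/
theorem InfModels.ge_iff (h : InfModels A (TDense τ)) {n : ℕ} (φ : CFormula τ n) (r : QUnit)
    (x : Fin n → A) : Structure.RelMap (L := τ.plus) (PlusRel.ge φ r) x ↔
      ((r : ℚ) : ℝ) ≤ pval A n φ x := by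
  have hbdd : BddAbove {q : ℝ | ∃ r : QUnit, ((r : ℚ) : ℝ) = q ∧
      Structure.RelMap (L := τ.plus) (PlusRel.ge φ r) x} := by
    refine ⟨1, ?_⟩
    rintro _ ⟨r, rfl, -⟩
    exact_mod_cast r.2.2
  have hb := h.realize_denseAxiom (.bounds φ) x
  rw [InfFormula.realize_and] at hb
  have h0 := (realize_geF_of_mem φ ⟨0, by simp⟩ vars x).1 hb.1
  refine ⟨fun hr => le_csSup hbdd ⟨r, rfl, hr⟩, fun hr => ?_⟩
  have hl := h.realize_denseAxiom (.ge_limit φ r) x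
  rw [InfFormula.realize_imp, realize_geF_of_mem] at hl
  refine hl fun m => ?_
  by_cases hq : (r : ℚ) - 1 / (m + 1) < 0
  · exact realize_geF_of_neg φ hq _ _
  have hm : (0 : ℚ) < 1 / (m + 1) := by positivity
  have hmem : (r : ℚ) - 1 / (m + 1) ∈ Icc (0 : ℚ) 1 :=
    ⟨not_lt.1 hq, by linarith [r.2.2]⟩
  have hlt : (((r : ℚ) - 1 / (m + 1) : ℚ) : ℝ) < pval A n φ x :=
    lt_of_lt_of_le (by exact_mod_cast sub_lt_self _ hm) hr
  obtain ⟨_, ⟨s, rfl, hs⟩, hs'⟩ := exists_lt_of_lt_csSup (by exact ⟨_, _, rfl, h0⟩) hlt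
  have hmono := h.realize_denseAxiom
    (.ge_mono φ s ⟨_, hmem⟩ (le_of_lt (by exact_mod_cast hs'))) x
  rw [InfFormula.realize_imp, realize_geF_of_mem] at hmono
  exact hmono hs

/-- A value above `r` would leave a rational strictly between them, against the axiom `order`.
Conversely, at every `r + 1 / (m + 1)` the relation `≥` fails, so `≤` holds there, and the limit
axiom applies. -/
theorem InfModels.le_iff (h : InfModels A (TDense τ)) {n : ℕ} (φ : CFormula τ n) (r : QUnit)
    (x : Fin n → A) : Structure.RelMap (L := τ.plus) (PlusRel.le φ r) x ↔
      pval A n φ x ≤ ((r : ℚ) : ℝ) := by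
  constructor
  · intro hr
    refine le_of_forall_lt_imp_le_of_dense fun c hc => le_of_not_gt fun hrc => ?_
    obtain ⟨s, hs1, hs2⟩ := exists_rat_btwn hrc
    have hm := h.pval_mem φ x
    have hrs : (r : ℚ) < s := by exact_mod_cast hs1
    have hmem : s ∈ Icc (0 : ℚ) 1 := ⟨r.2.1.trans hrs.le, by
      have : (s : ℝ) ≤ 1 := by linarith [hm.2]
      exact_mod_cast this⟩
    have ho := h.realize_denseAxiom (.order φ ⟨s, hmem⟩ r hrs) x
    rw [InfFormula.realize_or, InfFormula.realize_neg, InfFormula.realize_neg,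
      realize_geF_of_mem, realize_leF_of_mem, realize_vars, h.ge_iff] at ho
    exact ho.elim (fun ho => ho (hs2.trans hc).le) (fun ho => ho hr)
  · intro hr
    have hl := h.realize_denseAxiom (.le_limit φ r) x
    rw [InfFormula.realize_imp, realize_leF_of_mem] at hl
    refine hl fun m => ?_
    have hm : (0 : ℚ) < 1 / (m + 1) := by positivity
    by_cases hq : 1 < (r : ℚ) + 1 / (m + 1)
    · exact realize_leF_of_one_lt φ hq _ _
    have hmem : (r : ℚ) + 1 / (m + 1) ∈ Icc (0 : ℚ) 1 :=
      ⟨by linarith [r.2.1], not_lt.1 hq⟩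
    have hn := h.realize_denseAxiom (.le_of_not_ge φ ⟨_, hmem⟩) x
    rw [InfFormula.realize_imp, InfFormula.realize_neg, realize_geF_of_mem, realize_vars,
      h.ge_iff] at hn
    refine hn (not_le.2 (lt_of_le_of_lt hr ?_))
    exact_mod_cast lt_add_of_pos_right _ hm

/-- Each clause is tested against rational cuts, where it becomes the corresponding axiom. The
clauses for `∸` and substitution come first because the axiom of uniform continuity for relations
speaks of the formula `diffF R`. -/
theorem InfModels.isPlusVal [Nonempty A] (h : InfModels A (TDense τ)) :
    IsPlusVal A (pval A : Valuation τ A) := by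
  have G {k n : ℕ} (φ : CFormula τ k) (q : ℚ) (ts : Fin k → τ.plus.Term (Fin n)) (x : Fin n → A) :=
    realize_geF (v := pval A) h.pval_mem h.ge_iff φ q ts x
  have L {k n : ℕ} (φ : CFormula τ k) (q : ℚ) (ts : Fin k → τ.plus.Term (Fin n)) (x : Fin n → A) :=
    realize_leF (v := pval A) h.pval_mem h.le_iff φ q ts x
  have ax {n : ℕ} {φ : InfFormula τ.plus n} (hφ : DenseAxiom τ φ) (x : Fin n → A) :=
    h.realize_denseAxiom hφ x
  have mem := @InfModels.pval_mem τ A _ h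
  have hmonus {n} (φ ψ : CFormula τ n) x :
      pval A n (.monus φ ψ) x = max (pval A n φ x - pval A n ψ x) 0 := by
    refine eq_of_forall_qunit (mem _ _) ⟨le_max_right _ _, max_le ?_ zero_le_one⟩ fun r => ?_
    · linarith [(mem φ x).2, (mem ψ x).1]
    have h1 := ax (.monus_le φ ψ r) x
    simp only [InfFormula.realize_iff, InfFormula.realize_iAnd, InfFormula.realize_iOr,
      InfFormula.realize_and, G, L, realize_vars] at h1
    have hr : (0 : ℝ) ≤ ((r : ℚ) : ℝ) := by exact_mod_cast r.2.1
    have h2 := mem ψ x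
    rw [h1]
    push_cast
    constructor
    · intro hr1
      refine max_le (le_of_forall_sub_nat fun m => ?_) hr
      obtain ⟨s, hs, hs2⟩ := hr1 m
      linarith
    · intro hr1 m
      have hm : (0 : ℝ) < 1 / (m + 1) := by positivity
      have hr1 := (max_le_iff.1 hr1).1
      obtain ⟨s, hs⟩ := exists_qunit_between
        (show pval A n ψ x - 1 / (m + 1) < pval A n ψ x by linarith) (by linarith [h2.2]) h2.1
      exact ⟨s, hs.2, by linarith⟩
  have hsubst {k n} (φ : CFormula τ k) (t : Fin k → τ.funLang.Term (Fin n)) (x : Fin n → A) :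
      pval A n (φ.subst t) x = pval A k φ (fun i => (t i).realize x) := by
    refine eq_of_forall_qunit (mem _ _) (mem _ _) fun r => ?_
    have h1 := ax (.subst_le φ t r) x
    simp only [InfFormula.realize_iff, L, realize_vars, realize_toPlus] at h1
    exact h1.symm
  have hdist {n} (s t : τ.plus.Term (Fin n)) (x : Fin n → A) :
      pval A 2 (dF : CFormula τ 2) (fun i => ((![s, t] : Fin 2 → _) i).realize x) =
        pval A 2 (dF : CFormula τ 2) ![s.realize x, t.realize x] := by
    rw [realize_pair]
  have hzero (a b : A) : pval A 2 (dF : CFormula τ 2) ![a, b] = 0 ↔ a = b := by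
    have h1 := ax .dist_zero ![a, b]
    rw [InfFormula.realize_iff, L, realize_vars] at h1
    rw [← show _ ↔ a = b from h1]
    push_cast
    exact ⟨fun h => h.le, fun h => le_antisymm h (mem _ _).1⟩
  refine ⟨⟨mem, ?_, ?_, ?_, hmonus, ?_, ?_, hsubst, ?_, ?_, ?_, ?_, ?_⟩, h.ge_iff, h.le_iff,
    fun a b => (hzero a b).1⟩
  · intro n x
    have h0 := mem (.zero : CFormula τ n) x
    refine le_antisymm (le_of_forall_gt_imp_ge_of_dense fun c hc => ?_) h0.1
    by_contra! hlt
    obtain ⟨s, hs1, hs2⟩ := exists_rat_btwn hlt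
    have hs0 : (0 : ℚ) < s := by exact_mod_cast hc.trans hs1
    have hmem : s ∈ Icc (0 : ℚ) 1 := ⟨hs0.le, by
      have : (s : ℝ) ≤ 1 := by linarith [h0.2]
      exact_mod_cast this⟩
    have h1 := ax (.consts (n := n) ⟨s, hmem⟩ hs0) x
    rw [InfFormula.realize_and, InfFormula.realize_neg, G] at h1
    exact h1.1 hs2.le
  · intro n x
    have h0 := mem (.one : CFormula τ n) x
    refine le_antisymm h0.2 (le_of_forall_lt_imp_le_of_dense fun c hc => ?_)
    by_contra! hlt
    obtain ⟨s, hs1, hs2⟩ := exists_rat_btwn hlt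
    have hs0 : s < (1 : ℚ) := by exact_mod_cast hs2.trans hc
    have hmem : s ∈ Icc (0 : ℚ) 1 := ⟨by
      have : (0 : ℝ) ≤ s := by linarith [h0.1]
      exact_mod_cast this, hs0.le⟩
    -- With `t = 1 - s` the axiom denies that the value of `1` is at most `1 - t = s`.
    have h1 := ax (.consts (n := n) ⟨1 - s, by linarith [hmem.2], by linarith [hmem.1]⟩
      (by simpa [← Subtype.coe_lt_coe] using hs0)) x
    rw [InfFormula.realize_and, InfFormula.realize_neg, InfFormula.realize_neg, L] at h1
    refine h1.2 ?_
    rw [realize_vars]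
    push_cast
    linarith
  · intro n φ x
    have h0 := mem φ x
    refine eq_of_forall_qunit (mem _ _) ⟨by linarith [h0.1], by linarith [h0.2]⟩ fun r => ?_
    have h1 := ax (.half_le φ r) x
    simp only [InfFormula.realize_iff, L, realize_vars] at h1
    rw [h1]
    push_cast
    constructor <;> intro <;> linarith
  · intro n φ x
    have hne : (range fun a : A => pval A (n + 1) φ (Fin.snoc x a : Fin (n + 1) → A)).Nonempty :=
      range_nonempty _
    have hbdd : BddAbove (range fun a : A => pval A (n + 1) φ (Fin.snoc x a : Fin (n + 1) → A)) :=
      ⟨1, by rintro _ ⟨a, rfl⟩; exact (mem _ _).2⟩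
    have hl := isLUB_csSup hne hbdd
    suffices key : pval A n (.sup φ) x =
        sSup (range fun a : A => pval A (n + 1) φ (Fin.snoc x a : Fin (n + 1) → A)) by
      rw [key]
      exact hl
    refine eq_of_forall_qunit (mem _ _)
      ⟨(mem _ _).1.trans (hl.1 ⟨Classical.arbitrary A, rfl⟩), hl.2 ?_⟩ fun r => ?_
    · rintro _ ⟨a, rfl⟩
      exact (mem _ _).2
    have h1 := ax (.sup_le φ r) x
    simp only [InfFormula.realize_iff, InfFormula.realize_all, L, realize_vars] at h1
    rw [h1, isLUB_le_iff hl]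
    simp [upperBounds]
  · intro n φ x
    have hne : (range fun a : A => pval A (n + 1) φ (Fin.snoc x a : Fin (n + 1) → A)).Nonempty :=
      range_nonempty _
    have hbdd : BddBelow (range fun a : A => pval A (n + 1) φ (Fin.snoc x a : Fin (n + 1) → A)) :=
      ⟨0, by rintro _ ⟨a, rfl⟩; exact (mem _ _).1⟩
    have hl := isGLB_csInf hne hbdd
    suffices key : pval A n (.inf φ) x =
        sInf (range fun a : A => pval A (n + 1) φ (Fin.snoc x a : Fin (n + 1) → A)) by
      rw [key]
      exact hl
    refine eq_of_forall_qunit (mem _ _)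
      ⟨hl.2 ?_, (hl.1 ⟨Classical.arbitrary A, rfl⟩).trans (mem _ _).2⟩ fun r => ?_
    · rintro _ ⟨a, rfl⟩
      exact (mem _ _).1
    have h1 := ax (.inf_le φ r) x
    simp only [InfFormula.realize_iff, InfFormula.realize_iAnd, InfFormula.realize_ex, L,
      realize_vars] at h1
    rw [h1]
    push_cast
    constructor
    · intro hr
      refine le_of_forall_sub_nat fun m => ?_
      obtain ⟨a, ha⟩ := hr m
      linarith [hl.1 ⟨a, rfl⟩]
    · intro hr m
      have hm : (0 : ℝ) < 1 / (m + 1) := by positivity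
      obtain ⟨_, ⟨a, rfl⟩, -, ha⟩ := hl.exists_between
        (lt_of_le_of_lt hr (lt_add_of_pos_right _ hm))
      exact ⟨a, ha.le⟩
  · exact fun a => (hzero a a).2 rfl
  · intro a b
    refine eq_of_forall_qunit (mem _ _) (mem _ _) fun r => ?_
    have h1 := ax (.dist_comm_le r) ![a, b]
    rw [InfFormula.realize_iff, L, L, hdist, hdist] at h1
    exact h1
  · intro a b c
    refine le_of_forall_lt_imp_le_of_dense fun r hr => ?_
    have hac := mem dF ![a, c]
    obtain ⟨s, hs1, hs2⟩ := exists_qunit_between hr (hr.le.trans hac.2) hac.1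
    refine hs1.trans (le_of_forall_sub_nat fun m => ?_)
    have h1 := ax (.dist_triangle s) ![a, c]
    simp only [InfFormula.realize_imp, InfFormula.realize_all, InfFormula.realize_iAnd,
      InfFormula.realize_iOr, InfFormula.realize_and, G, hdist] at h1
    obtain ⟨t, ht⟩ := h1 hs2 b m
    have e0 : (Fin.snoc ![a, c] b : Fin 3 → A) 0 = a := rfl
    have e1 : (Fin.snoc ![a, c] b : Fin 3 → A) 1 = c := rfl
    have e2 : (Fin.snoc ![a, c] b : Fin 3 → A) 2 = b := rfl
    simp only [Term.realize_var] at ht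
    rw [e0, e1, e2] at ht
    push_cast at ht
    linarith
  · intro n F r hr0 hr1 x y hxy
    obtain ⟨s, hs, hs'⟩ := exists_qunit_lt_of_forall_lt (fun i => mem dF ![x i, y i])
      (τ.funMod_pos F r hr0 hr1) hxy
    have h1 := ax (.func_unif F ⟨r, hr0.le, hr1⟩ s hr0 hs') (Fin.append x y)
    simp only [InfFormula.realize_imp, InfFormula.realize_iAnd, L, hdist, realize_varsL,
      realize_varsR] at h1
    have e1 : ∀ f : Fin n → τ.plus.Term (Fin (n + n)),
      (Term.func (L := τ.plus) F f).realize (Fin.append x y) =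
        Structure.funMap (L := τ.funLang) F (fun i => (f i).realize (Fin.append x y)) :=
      fun _ => rfl
    simp only [e1, realize_varsL, realize_varsR] at h1
    exact h1 hs
  · intro n R r hr0 hr1 x y hxy
    obtain ⟨s, hs, hs'⟩ := exists_qunit_lt_of_forall_lt (fun i => mem dF ![x i, y i])
      (τ.relMod_pos R r hr0 hr1) hxy
    have h1 := ax (.rel_unif R ⟨r, hr0.le, hr1⟩ s hr0 hs') (Fin.append x y)
    simp only [InfFormula.realize_imp, InfFormula.realize_iAnd, InfFormula.realize_and, L, hdist,
      realize_append, realize_varsL, realize_varsR] at h1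
    have h2 := h1 hs
    rw [val_diffF hmonus hsubst, val_diffF hmonus hsubst, max_le_iff, max_le_iff] at h2
    rw [abs_le]
    constructor <;> linarith

end


/-! ## Continuity of truth values -/

section Continuity

variable {τ : CLanguage.{u}} (M : CStructure τ)

theorem CFormula.val_mem {n : ℕ} (φ : CFormula τ n) (x : Fin n → M) :
    φ.val M x ∈ Icc (0 : ℝ) 1 := by
  induction φ with
  | dist s t => exact ⟨dist_nonneg, M.dist_le_one _ _⟩
  | rel R ts => exact M.rel_mem _ _
  | zero => simp [val]
  | one => simp [val]
  | half φ ih =>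
    have := ih x
    simp only [val]
    constructor <;> linarith [this.1, this.2]
  | monus φ ψ ih ih' =>
    have h1 := ih x
    have h2 := ih' x
    exact ⟨le_max_right _ _, max_le (by linarith [h1.2, h2.1]) zero_le_one⟩
  | sup φ ih =>
    exact ⟨Real.iSup_nonneg fun a => (ih _).1, ciSup_le fun a => (ih _).2⟩
  | inf φ ih =>
    exact ⟨Real.iInf_nonneg fun a => (ih _).1, (ciInf_le
      ⟨0, by rintro _ ⟨a, rfl⟩; exact (ih _).1⟩ (Classical.arbitrary M)).trans (ih _).2⟩

theorem CFormula.isLUB_val_sup {n : ℕ} (φ : CFormula τ (n + 1)) (x : Fin n → M) :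
    IsLUB (range fun a : M => φ.val M (Fin.snoc x a : Fin (n + 1) → M)) (φ.sup.val M x) :=
  isLUB_ciSup ⟨1, by rintro _ ⟨a, rfl⟩; exact (φ.val_mem M _).2⟩

theorem CFormula.isGLB_val_inf {n : ℕ} (φ : CFormula τ (n + 1)) (x : Fin n → M) :
    IsGLB (range fun a : M => φ.val M (Fin.snoc x a : Fin (n + 1) → M)) (φ.inf.val M x) :=
  isGLB_ciInf ⟨0, by rintro _ ⟨a, rfl⟩; exact (φ.val_mem M _).1⟩

theorem uniformContinuous_of_modulus {n : ℕ} {X Y : Type*} [PseudoMetricSpace X]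
    [PseudoMetricSpace Y] {f : (Fin n → X) → Y} {Δ : ℚ → ℝ}
    (hΔ : ∀ r : ℚ, 0 < r → r ≤ 1 → 0 < Δ r)
    (hf : ∀ r : ℚ, 0 < r → r ≤ 1 → ∀ x y, (∀ i, dist (x i) (y i) < Δ r) → dist (f x) (f y) ≤ r) :
    UniformContinuous f := by
  rw [Metric.uniformContinuous_iff]
  intro ε hε
  -- The moduli are only prescribed for rational `r` in `(0, 1]`, so `ε` is cut off at 1.
  obtain ⟨r, hr0, hr⟩ := exists_rat_btwn (show (0 : ℝ) < min ε 1 by positivity)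
  rw [lt_min_iff] at hr
  have h0 : 0 < r := by exact_mod_cast hr0
  have h1 : r ≤ 1 := by exact_mod_cast hr.2.le
  exact ⟨Δ r, hΔ r h0 h1, fun x y hxy =>
    (hf r h0 h1 x y fun i => (dist_le_pi_dist x y i).trans_lt hxy).trans_lt hr.1⟩

theorem CStructure.uniformContinuous_func {n : ℕ} (F : τ.Func n) : UniformContinuous (M.func F) :=
  uniformContinuous_of_modulus (τ.funMod_pos F) (M.func_unif F)

theorem CStructure.uniformContinuous_rel {n : ℕ} (R : τ.Rel n) : UniformContinuous (M.rel R) :=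
  uniformContinuous_of_modulus (τ.relMod_pos R) (M.rel_unif R)

theorem uniformContinuous_realize {n : ℕ} (t : τ.funLang.Term (Fin n)) :
    UniformContinuous fun x : Fin n → M => t.realize x := by
  induction t with
  | var i => exact Pi.uniformContinuous_proj _ i
  | func F ts ih => exact (M.uniformContinuous_func F).comp (uniformContinuous_pi.2 ih)

theorem dist_snoc_le {X : Type*} [PseudoMetricSpace X] {n : ℕ} (x y : Fin n → X) (a : X) :
    dist (Fin.snoc x a : Fin (n + 1) → X) (Fin.snoc y a) ≤ dist x y := by
  rw [dist_pi_le_iff dist_nonneg]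
  intro i
  refine Fin.lastCases ?_ (fun i => ?_) i
  · simp
  · simpa using dist_le_pi_dist x y i

/-- For a quantifier, the uniform `δ` of the matrix works for all values of the bound variable at
once. Halving `ε` keeps the inequality strict after passing to the sup or inf. -/
theorem CFormula.uniformContinuous_val {n : ℕ} (φ : CFormula τ n) :
    UniformContinuous (φ.val M) := by
  induction φ with
  | dist s t => exact (uniformContinuous_realize M s).dist (uniformContinuous_realize M t)
  | rel R ts =>
    exact (M.uniformContinuous_rel R).comp
      (uniformContinuous_pi.2 fun i => uniformContinuous_realize M (ts i))
  | zero => exact uniformContinuous_const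
  | one => exact uniformContinuous_const
  | half φ ih => exact ih.div_const' 2
  | monus φ ψ ih ih' =>
    have : LipschitzWith 1 fun t : ℝ => max t 0 := LipschitzWith.id.max_const 0
    exact this.uniformContinuous.comp (ih.sub ih')
  | @sup n φ ih =>
    rw [Metric.uniformContinuous_iff] at ih ⊢
    intro ε hε
    obtain ⟨δ, hδ, h⟩ := ih (ε / 2) (half_pos hε)
    have key (x y : Fin n → M) (hxy : Dist.dist x y < δ) :
        φ.sup.val M x ≤ φ.sup.val M y + ε / 2 := by
      rw [isLUB_le_iff (φ.isLUB_val_sup M x)]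
      rintro _ ⟨a, rfl⟩
      have h1 := h ((dist_snoc_le x y a).trans_lt hxy)
      rw [Real.dist_eq, abs_lt] at h1
      linarith [(φ.isLUB_val_sup M y).1 ⟨a, rfl⟩]
    refine ⟨δ, hδ, fun x y hxy => ?_⟩
    have h1 := key x y hxy
    have h2 := key y x (_root_.dist_comm x y ▸ hxy)
    rw [Real.dist_eq, abs_lt]
    constructor <;> linarith
  | @inf n φ ih =>
    rw [Metric.uniformContinuous_iff] at ih ⊢
    intro ε hε
    obtain ⟨δ, hδ, h⟩ := ih (ε / 2) (half_pos hε)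
    have key (x y : Fin n → M) (hxy : Dist.dist x y < δ) :
        φ.inf.val M x - ε / 2 ≤ φ.inf.val M y := by
      rw [le_isGLB_iff (φ.isGLB_val_inf M y)]
      rintro _ ⟨a, rfl⟩
      have h1 := h ((dist_snoc_le x y a).trans_lt hxy)
      rw [Real.dist_eq, abs_lt] at h1
      linarith [(φ.isGLB_val_inf M x).1 ⟨a, rfl⟩]
    refine ⟨δ, hδ, fun x y hxy => ?_⟩
    have h1 := key x y hxy
    have h2 := key y x (_root_.dist_comm x y ▸ hxy)
    rw [Real.dist_eq, abs_lt]
    constructor <;> linarith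

theorem CFormula.continuous_val {n : ℕ} (φ : CFormula τ n) : Continuous (φ.val M) :=
  (φ.uniformContinuous_val M).continuous

theorem realize_snoc_terms {n m : ℕ} (t : Fin n → τ.funLang.Term (Fin m)) (x : Fin m → M) (a : M) :
    (fun i => ((Fin.snoc (fun i => (t i).relabel Fin.castSucc) (Term.var (Fin.last m)) :
        Fin (n + 1) → τ.funLang.Term (Fin (m + 1))) i).realize (Fin.snoc x a : Fin (m + 1) → M)) =
      (Fin.snoc (fun i => (t i).realize x) a : Fin (n + 1) → M) := by
  ext i
  refine Fin.lastCases ?_ (fun i => ?_) i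
  · simp
  · simp [Function.comp_def]

theorem CFormula.val_subst {n : ℕ} (φ : CFormula τ n) {m : ℕ} (t : Fin n → τ.funLang.Term (Fin m))
    (x : Fin m → M) : (φ.subst t).val M x = φ.val M (fun i => (t i).realize x) := by
  induction φ generalizing m with
  | dist s t => simp [subst, val]
  | rel R ts => simp [subst, val]
  | zero => rfl
  | one => rfl
  | half φ ih => simp [subst, val, ih]
  | monus φ ψ ih ih' => simp [subst, val, ih, ih']
  | sup φ ih => simp only [subst, val, ih, realize_snoc_terms]
  | inf φ ih => simp only [subst, val, ih, realize_snoc_terms]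

end Continuity

/-! ## Dense subsets -/

/-- A bound on a continuous function is a closed condition. Consequently quantification over a dense
subset gives the same sup as over the whole space. -/
theorem DenseRange.upperBounds_range {X Y : Type*} [TopologicalSpace X] {i : Y → X}
    (hi : DenseRange i) {g : X → ℝ} (hg : Continuous g) :
    upperBounds (range fun a => g (i a)) = upperBounds (range g) := by
  ext b
  simp only [upperBounds, mem_range, forall_exists_index, forall_apply_eq_imp_iff, mem_ofPred_eq]
  exact ⟨fun h x => hi.induction_on x (isClosed_le hg continuous_const) h, fun h a => h _⟩

theorem DenseRange.lowerBounds_range {X Y : Type*} [TopologicalSpace X] {i : Y → X}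
    (hi : DenseRange i) {g : X → ℝ} (hg : Continuous g) :
    lowerBounds (range fun a => g (i a)) = lowerBounds (range g) := by
  ext b
  simp only [lowerBounds, mem_range, forall_exists_index, forall_apply_eq_imp_iff, mem_ofPred_eq]
  exact ⟨fun h x => hi.induction_on x (isClosed_le continuous_const hg) h, fun h a => h _⟩

section Dense

variable {τ : CLanguage.{u}} {M : CStructure τ} {A : Type w} [τ.funLang.Structure A] {i : A → M}

theorem realize_comp (hf : ∀ {n} (F : τ.Func n) (x : Fin n → A),
      i (Structure.funMap (L := τ.funLang) F x) = M.func F (i ∘ x))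
    {n : ℕ} (t : τ.funLang.Term (Fin n)) (x : Fin n → A) :
    t.realize (i ∘ x) = i (t.realize x) := by
  induction t with
  | var k => rfl
  | func F ts ih =>
    refine Eq.trans ?_ (hf F _).symm
    exact congrArg (M.func F) (funext ih)

theorem isVal_of_denseRange (hi : DenseRange i)
    (hf : ∀ {n} (F : τ.Func n) (x : Fin n → A),
      i (Structure.funMap (L := τ.funLang) F x) = M.func F (i ∘ x)) :
    IsVal (fun _ φ x => φ.val M (i ∘ x) : Valuation τ A) where
  mem φ x := φ.val_mem M _
  zero x := rfl
  one x := rfl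
  half φ x := rfl
  monus φ ψ x := rfl
  sup {n} φ x := by
    simp only [Fin.comp_snoc]
    rw [IsLUB, DenseRange.upperBounds_range hi
      (g := fun a : M => φ.val M (Fin.snoc (i ∘ x) a : Fin (n + 1) → M))]
    · exact φ.isLUB_val_sup M _
    · exact (φ.continuous_val M).comp (continuous_const.finSnoc continuous_id)
  inf {n} φ x := by
    simp only [Fin.comp_snoc]
    rw [IsGLB, DenseRange.lowerBounds_range hi
      (g := fun a : M => φ.val M (Fin.snoc (i ∘ x) a : Fin (n + 1) → M))]
    · exact φ.isGLB_val_inf M _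
    · exact (φ.continuous_val M).comp (continuous_const.finSnoc continuous_id)
  subst φ t x := by
    rw [CFormula.val_subst]
    congr 1
    ext k
    exact realize_comp hf _ _
  dist_self a := dist_self (i a)
  dist_comm a b := dist_comm (i a) (i b)
  dist_triangle a b c := dist_triangle (i a) (i b) (i c)
  func_unif F r h0 h1 x y hxy := by
    have := M.func_unif F r h0 h1 (i ∘ x) (i ∘ y) hxy
    rw [← hf, ← hf] at this
    exact this
  rel_unif R r h0 h1 x y hxy := M.rel_unif R r h0 h1 (i ∘ x) (i ∘ y) hxy

end Dense

/-! ## Completion of a valuation -/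

section ExtendPi

open UniformSpace

variable {α : Type*} [PseudoMetricSpace α] {n : ℕ}

theorem isUniformInducing_coe_pi :
    IsUniformInducing (fun (x : Fin n → α) k => (x k : Completion α)) :=
  (Isometry.piMap (fun _ => ((↑) : α → Completion α))
    (fun _ => Completion.coe_isometry)).isUniformInducing

theorem denseRange_coe_pi : DenseRange (fun (x : Fin n → α) k => (x k : Completion α)) :=
  DenseRange.piMap (f := fun (_ : Fin n) (a : α) => (a : Completion α))
    fun _ => Completion.denseRange_coe

variable {γ : Type*} [MetricSpace γ] {f : (Fin n → α) → γ}

/-- The continuous extension of a function of finitely many variables to the completion. -/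
noncomputable def extendPi (f : (Fin n → α) → γ) : (Fin n → Completion α) → γ :=
  (isUniformInducing_coe_pi.isDenseInducing denseRange_coe_pi).extend f

theorem continuous_extendPi [CompleteSpace γ] (hf : UniformContinuous f) : Continuous (extendPi f) :=
  (uniformContinuous_uniformly_extend isUniformInducing_coe_pi denseRange_coe_pi hf).continuous

theorem extendPi_coe (hf : UniformContinuous f) (x : Fin n → α) :
    extendPi f (fun k => (x k : Completion α)) = f x :=
  uniformly_extend_of_ind isUniformInducing_coe_pi denseRange_coe_pi hf x

/-- The modulus survives completion unchanged because its hypothesis `<` is open and its conclusion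
`≤` is closed: a point of an open set is a limit of points of the dense subset that lie in it. -/
theorem dist_extendPi_le [CompleteSpace γ] (hf : UniformContinuous f) {Δ r : ℝ}
    (h : ∀ x y, (∀ i, dist (x i) (y i) < Δ) → dist (f x) (f y) ≤ r)
    (x y : Fin n → Completion α) (hxy : ∀ i, dist (x i) (y i) < Δ) :
    dist (extendPi f x) (extendPi f y) ≤ r := by
  have hc := continuous_extendPi hf
  have hU : IsOpen {p : (Fin n → Completion α) × (Fin n → Completion α) |
      ∀ i, dist (p.1 i) (p.2 i) < Δ} := by
    simp only [ofPred_forall]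
    exact isOpen_iInter_of_finite fun i => isOpen_lt (by fun_prop) continuous_const
  have hD := (denseRange_coe_pi (α := α) (n := n)).prodMap (denseRange_coe_pi (α := α) (n := n))
  have hC : IsClosed {p : (Fin n → Completion α) × (Fin n → Completion α) |
      dist (extendPi f p.1) (extendPi f p.2) ≤ r} :=
    isClosed_le (by fun_prop) continuous_const
  refine (closure_minimal ?_ hC) (hD.open_subset_closure_inter hU (show (x, y) ∈ _ from hxy))
  rintro _ ⟨hp, ⟨⟨a, b⟩, rfl⟩⟩
  simp only [Prod.map, mem_ofPred_eq, Completion.dist_eq] at hp ⊢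
  rw [extendPi_coe hf, extendPi_coe hf]
  exact h a b hp

end ExtendPi

section Completion

open UniformSpace

variable {τ : CLanguage.{u}} {A : Type u} [τ.funLang.Structure A] {v : Valuation τ A}

/-- The pseudometric of a valuation. -/
abbrev IsVal.pseudoMetricSpace (h : IsVal v) : PseudoMetricSpace A where
  dist a b := v 2 dF ![a, b]
  dist_self := h.dist_self
  dist_comm := h.dist_comm
  dist_triangle := h.dist_triangle

theorem IsVal.uniformContinuous_func (h : IsVal v) {n : ℕ} (F : τ.Func n) :
    letI := h.pseudoMetricSpace
    UniformContinuous fun x : Fin n → A =>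
      ((Structure.funMap (L := τ.funLang) F x : A) : Completion A) := by
  let := h.pseudoMetricSpace
  exact (Completion.uniformContinuous_coe A).comp
    (uniformContinuous_of_modulus (τ.funMod_pos F) (h.func_unif F))

theorem IsVal.uniformContinuous_rel (h : IsVal v) {n : ℕ} (R : τ.Rel n) :
    letI := h.pseudoMetricSpace
    UniformContinuous fun x : Fin n → A => v n (.rel R .var) x := by
  let := h.pseudoMetricSpace
  exact uniformContinuous_of_modulus (τ.relMod_pos R) (h.rel_unif R)

/-- The completion of a valuation. -/
noncomputable def IsVal.completion [Nonempty A] (h : IsVal v) : CStructure τ :=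
  letI := h.pseudoMetricSpace
  { Carrier := Completion A
    nonempty := ⟨((Classical.arbitrary A : A) : Completion A)⟩
    dist_le_one := fun x y => by
      refine Completion.induction_on₂ x y (isClosed_le (by fun_prop) continuous_const) fun a b => ?_
      rw [Completion.dist_eq]
      exact (h.mem _ _).2
    func := fun F => extendPi fun x => ((Structure.funMap (L := τ.funLang) F x : A) : Completion A)
    rel := fun {n} R => extendPi fun x => v n (.rel R .var) x
    rel_mem := fun R x => by
      refine denseRange_coe_pi.induction_on x
        (isClosed_Icc.preimage (continuous_extendPi (h.uniformContinuous_rel R))) fun a => ?_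
      exact (extendPi_coe (h.uniformContinuous_rel R) a).symm ▸ h.mem _ _
    func_unif := fun F r h0 h1 => dist_extendPi_le (h.uniformContinuous_func F) fun x y hxy => by
      rw [Completion.dist_eq]
      exact h.func_unif F r h0 h1 x y hxy
    rel_unif := fun R r h0 h1 => dist_extendPi_le (h.uniformContinuous_rel R)
      (h.rel_unif R r h0 h1) }

theorem IsVal.exists_completion [Nonempty A] (h : IsVal v) :
    ∃ (M : CStructure τ) (i : A → M), DenseRange i ∧
      (∀ {n} (F : τ.Func n) (x : Fin n → A),
        i (Structure.funMap (L := τ.funLang) F x) = M.func F (i ∘ x)) ∧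
      ∀ {n} (φ : CFormula τ n) (x : Fin n → A), φ.val M (i ∘ x) = v n φ x := by
  let := h.pseudoMetricSpace
  let i : A → h.completion := fun a => (a : Completion A)
  have hi : DenseRange i := Completion.denseRange_coe
  have hf {n} (F : τ.Func n) (x : Fin n → A) :
      i (Structure.funMap (L := τ.funLang) F x) = h.completion.func F (i ∘ x) :=
    (extendPi_coe (h.uniformContinuous_func F) x).symm
  refine ⟨h.completion, i, hi, hf, fun {n} φ x => ?_⟩
  -- Truth in the completion, restricted to `A`, is itself a valuation. Its quantifiers also range
  -- over `A`, so in the induction both values are the same supremum or infimum.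
  have hv := isVal_of_denseRange hi hf
  induction φ with
  | dist s t =>
    rw [h.dist, CFormula.val, realize_comp hf, realize_comp hf]
    exact Completion.dist_eq _ _
  | rel R ts =>
    rw [h.rel, CFormula.val]
    simp only [realize_comp hf]
    exact extendPi_coe (h.uniformContinuous_rel R) _
  | zero => exact (h.zero x).symm
  | one => exact (h.one x).symm
  | half φ ih => rw [h.half, ← ih]; rfl
  | monus φ ψ ih ih' => rw [h.monus, ← ih, ← ih']; rfl
  | sup φ ih =>
    have h1 := h.sup φ x
    simp only [← ih] at h1
    exact (hv.sup φ x).unique h1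
  | inf φ ih =>
    have h1 := h.inf φ x
    simp only [← ih] at h1
    exact (hv.inf φ x).unique h1

end Completion

/-! ## Elementary maps -/

section Elementary

variable {τ : CLanguage.{u}} {M N P : CStructure τ}

theorem IsElementary.comp {g : N → P} {h : M → N} (hg : IsElementary g) (hh : IsElementary h) :
    IsElementary (g ∘ h) := fun n φ x => (hg n φ (h ∘ x)).trans (hh n φ x)

theorem IsElementary.isometry {h : M → N} (hh : IsElementary h) : Isometry h :=
  Isometry.of_dist_eq fun a b => hh 2 dF ![a, b]

/-- The formula `d(F(x), y)` has value 0 at `y = F(x)`, and this value is preserved. -/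
theorem IsElementary.map_func {h : M → N} (hh : IsElementary h) {n : ℕ} (F : τ.Func n)
    (x : Fin n → M) : h (M.func F x) = N.func F (h ∘ x) := by
  have h1 (P : CStructure τ) (y : Fin n → P) (b : P) :
      (CFormula.dist (.func (L := τ.funLang) F fun i => .var i.castSucc)
        (.var (Fin.last n))).val P (Fin.snoc y b : Fin (n + 1) → P) = dist (P.func F y) b := by
    have e : (fun i : Fin n => (Fin.snoc y b : Fin (n + 1) → P) i.castSucc) = y := by simp
    change dist (P.func F fun i : Fin n => (Fin.snoc y b : Fin (n + 1) → P) i.castSucc)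
      ((Fin.snoc y b : Fin (n + 1) → P) (Fin.last n)) = _
    rw [e, Fin.snoc_last]
  have h2 := hh (n + 1) (.dist (.func (L := τ.funLang) F fun i => .var i.castSucc)
    (.var (Fin.last n))) (Fin.snoc x (M.func F x))
  rw [Fin.comp_snoc, h1, h1, dist_self] at h2
  exact (dist_eq_zero.1 h2).symm

/-- Preservation of `d` makes `k` an isometry for the pseudometric induced by `i`, so it extends to
`M` because `N` is complete. Equality of values passes from the dense set to `M` by continuity. -/
theorem exists_isElementary_of_denseRange {A : Type w} {i : A → M} (hi : DenseRange i) (k : A → N)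
    (h : ∀ {n} (φ : CFormula τ n) (x : Fin n → A), φ.val N (k ∘ x) = φ.val M (i ∘ x)) :
    ∃ f : M → N, IsElementary f ∧ ∀ a, f (i a) = k a := by
  let : PseudoMetricSpace A := PseudoMetricSpace.induced i inferInstance
  have hii : Isometry i := Isometry.of_dist_eq fun _ _ => rfl
  have hk : Isometry k := Isometry.of_dist_eq fun a b => h dF ![a, b]
  have hc := (uniformContinuous_uniformly_extend hii.isUniformInducing hi
    hk.uniformContinuous).continuous
  have he := uniformly_extend_of_ind hii.isUniformInducing hi hk.uniformContinuous
  refine ⟨_, fun n φ x => ?_, he⟩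
  refine (DenseRange.piMap (f := fun (_ : Fin n) => i) fun _ => hi).induction_on x
    (isClosed_eq ((φ.continuous_val N).comp ?_) (φ.continuous_val M)) fun a => ?_
  · exact continuous_pi fun j => hc.comp (continuous_apply j)
  · refine Eq.trans (congrArg _ ?_) (h φ a)
    ext j
    exact he (a j)

end Elementary


/-! ## Ultrapowers -/

section Ultrapower

open Filter Topology

variable {τ : CLanguage.{u}}

/-- By compactness of `[0, 1]`, values have limits along `U`. These limits form a valuation on `I →
M`, and its completion is the ultrapower; the content of Łoś's theorem lies in the quantifier
clauses. -/
theorem exists_ultrapower (M : CStructure τ) {I : Type u} (U : Ultrafilter I) :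
    ∃ (N : CStructure τ) (i : (I → M) → N), ∀ {n} (φ : CFormula τ n) (x : Fin n → I → M),
      Tendsto (fun k => φ.val M (fun j => x j k)) U (𝓝 (φ.val N (i ∘ x))) := by
  let : τ.funLang.Structure (I → M) :=
    { funMap := fun F x k => M.func F (fun j => x j k)
      RelMap := fun R _ => R.elim }
  have hlim {n} (φ : CFormula τ n) (x : Fin n → I → M) :
      ∃ l ∈ Icc (0 : ℝ) 1, Tendsto (fun k => φ.val M (fun j => x j k)) U (𝓝 l) :=
    isCompact_Icc.ultrafilter_le_nhds (U.map _) (by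
      rw [le_principal_iff]
      exact Eventually.of_forall (f := (U : Filter I)) fun k => φ.val_mem M fun j => x j k)
  choose v hmem hv using @hlim
  have hsnoc {n} (x : Fin n → I → M) (a : I → M) (k : I) :
      (fun j => (Fin.snoc x a : Fin (n + 1) → I → M) j k) =
        (Fin.snoc (fun j => x j k) (a k) : Fin (n + 1) → M) :=
    Fin.comp_snoc (fun b : I → M => b k) x a
  have hreal {n} (t : τ.funLang.Term (Fin n)) (x : Fin n → I → M) (k : I) :
      t.realize x k = t.realize fun j => x j k := by
    induction t with
    | var j => rfl
    | func F ts ih => exact congrArg (M.func F) (funext ih)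
  have hdist (x y : I → M) : Tendsto (fun k => dist (x k) (y k)) U (𝓝 (v dF ![x, y])) :=
    hv dF ![x, y]
  have h : IsVal (fun n φ x => v φ x : Valuation τ (I → M)) :=
    { mem := hmem
      zero := fun x => tendsto_nhds_unique (hv _ x) tendsto_const_nhds
      one := fun x => tendsto_nhds_unique (hv _ x) tendsto_const_nhds
      half := fun φ x => tendsto_nhds_unique (hv _ x) ((hv φ x).div_const 2)
      monus := fun φ ψ x => tendsto_nhds_unique (hv _ x)
        (((hv φ x).sub (hv ψ x)).max tendsto_const_nhds)
      sup := fun φ x => by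
        constructor
        · rintro _ ⟨a, rfl⟩
          refine le_of_tendsto_of_tendsto' (hv _ _) (hv _ _) fun k => ?_
          rw [hsnoc]
          exact (φ.isLUB_val_sup M _).1 ⟨a k, rfl⟩
        · intro b hb
          refine le_of_forall_pos_le_add fun ε hε => ?_
          -- The supremum need not be attained; witnesses within `ε` are chosen in every coordinate
          -- and collected into one element of `I → M`.
          have hex (k : I) : ∃ a : M, φ.sup.val M (fun j => x j k) ≤
              φ.val M (Fin.snoc (fun j => x j k) a : Fin (_ + 1) → M) + ε := by
            obtain ⟨_, ⟨a, rfl⟩, ha, -⟩ := (φ.isLUB_val_sup M (fun j => x j k)).exists_between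
              (sub_lt_self _ hε)
            exact ⟨a, by linarith⟩
          choose a ha using hex
          have h1 := hb ⟨a, rfl⟩
          have h2 : v φ.sup x ≤ v φ (Fin.snoc x a : Fin (_ + 1) → I → M) + ε := by
            refine le_of_tendsto_of_tendsto' (hv _ _) ((hv _ _).add_const ε) fun k => ?_
            rw [hsnoc]
            exact ha k
          linarith
      inf := fun φ x => by
        constructor
        · rintro _ ⟨a, rfl⟩
          refine le_of_tendsto_of_tendsto' (hv _ _) (hv _ _) fun k => ?_
          rw [hsnoc]
          exact (φ.isGLB_val_inf M _).1 ⟨a k, rfl⟩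
        · intro b hb
          refine le_of_forall_pos_le_add fun ε hε => ?_
          have hex (k : I) : ∃ a : M, φ.val M (Fin.snoc (fun j => x j k) a : Fin (_ + 1) → M) ≤
              φ.inf.val M (fun j => x j k) + ε := by
            obtain ⟨_, ⟨a, rfl⟩, -, ha⟩ := (φ.isGLB_val_inf M (fun j => x j k)).exists_between
              (lt_add_of_pos_right _ hε)
            exact ⟨a, ha.le⟩
          choose a ha using hex
          have h1 := hb ⟨a, rfl⟩
          have h2 : v φ (Fin.snoc x a : Fin (_ + 1) → I → M) ≤ v φ.inf x + ε := by
            refine le_of_tendsto_of_tendsto' (hv _ _) ((hv _ _).add_const ε) fun k => ?_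
            rw [hsnoc]
            exact ha k
          linarith
      subst := fun φ t x => by
        refine tendsto_nhds_unique (hv _ x) ?_
        have := hv φ (fun i => (t i).realize x)
        simpa only [CFormula.val_subst, hreal] using this
      dist_self := fun a => tendsto_nhds_unique (hdist a a) (by simp)
      dist_comm := fun a b => tendsto_nhds_unique (hdist a b)
        (by simpa only [dist_comm] using hdist b a)
      dist_triangle := fun a b c => le_of_tendsto_of_tendsto' (hdist a c)
        ((hdist a b).add (hdist b c)) fun k => dist_triangle _ _ _
      func_unif := fun F r h0 h1 x y hxy => by
        refine le_of_tendsto (hdist _ _) ?_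
        filter_upwards [eventually_all.2 fun i => (hdist (x i) (y i)).eventually_lt_const (hxy i)]
          with k hk
        exact M.func_unif F r h0 h1 _ _ hk
      rel_unif := fun R r h0 h1 x y hxy => by
        refine le_of_tendsto ((hv _ x).sub (hv _ y)).abs ?_
        filter_upwards [eventually_all.2 fun i => (hdist (x i) (y i)).eventually_lt_const (hxy i)]
          with k hk
        exact M.rel_unif R r h0 h1 _ _ hk }
  obtain ⟨M₀⟩ := M.nonempty
  have : Nonempty (I → M) := ⟨fun _ => M₀⟩
  obtain ⟨N, i, -, -, hN⟩ := h.exists_completion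
  refine ⟨N, i, fun φ x => ?_⟩
  rw [hN]
  exact hv φ x

end Ultrapower

/-! ## Definable combinations of formulas -/

section Combinations

variable {τ : CLanguage.{u}}

/-- The maps `x / 2` and `1 - x / 2` cover the two halves of the unit interval and halve the error,
so `m` of them bring the constant 0 within `2⁻ᵐ` of `r`. -/
theorem CFormula.exists_const (n : ℕ) (m : ℕ) {r : ℝ} (hr : r ∈ Icc (0 : ℝ) 1) :
    ∃ (c : CFormula τ n) (q : ℝ), |q - r| ≤ (1 / 2) ^ m ∧ q ∈ Icc (0 : ℝ) 1 ∧
      ∀ (M : CStructure τ) (x : Fin n → M), c.val M x = q := by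
  induction m generalizing r with
  | zero =>
    refine ⟨.zero, 0, ?_, by simp, fun _ _ => rfl⟩
    rw [abs_le]
    constructor <;> simp <;> linarith [hr.1, hr.2]
  | succ m ih =>
    rcases le_total r (1 / 2) with h | h
    · obtain ⟨c, q, h1, h2, h3⟩ := ih (r := 2 * r) ⟨by linarith [hr.1], by linarith⟩
      refine ⟨c.half, q / 2, ?_, ⟨by linarith [h2.1], by linarith [h2.2]⟩, fun M x => by
        rw [val, h3]⟩
      rw [pow_succ]
      rw [abs_le] at h1 ⊢
      constructor <;> linarith
    · obtain ⟨c, q, h1, h2, h3⟩ := ih (r := 2 * (1 - r)) ⟨by linarith [hr.2], by linarith⟩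
      refine ⟨.monus .one c.half, 1 - q / 2, ?_, ⟨by linarith [h2.2], by linarith [h2.1]⟩,
        fun M x => ?_⟩
      · rw [pow_succ]
        rw [abs_le] at h1 ⊢
        constructor <;> linarith
      · simp only [val, h3]
        exact max_eq_left (by linarith [h2.2])

/-- Inequalities with constants are zero conditions: `φ ∸ c` vanishes exactly when the value of `φ`
is at most that of `c`. Taking `c` within `ε / 2` of a point shifted by `ε / 2` gives each
inequality up to `ε`. -/
theorem CFormula.val_eq_of_forall_eq_zero {M N : CStructure τ} {n : ℕ} {x : Fin n → M}
    {y : Fin n → N} (h : ∀ φ : CFormula τ n, φ.val M x = 0 → φ.val N y = 0) (φ : CFormula τ n) :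
    φ.val N y = φ.val M x := by
  have hM := φ.val_mem M x
  have hN := φ.val_mem N y
  refine le_antisymm (le_of_forall_pos_le_add fun ε hε => ?_)
    (le_of_forall_pos_le_add fun ε hε => ?_)
  all_goals obtain ⟨m, hm⟩ := exists_pow_lt_of_lt_one (half_pos hε) (show (1 / 2 : ℝ) < 1 by norm_num)
  · by_cases h1 : 1 ≤ φ.val M x + ε / 2
    · linarith [hN.2]
    obtain ⟨c, q, hq, -, hc⟩ := exists_const (τ := τ) n m
      (r := φ.val M x + ε / 2) ⟨by linarith [hM.1], by linarith⟩
    rw [abs_le] at hq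
    have h2 := h (.monus φ c) (by
      simp only [val, hc]
      exact max_eq_right (by linarith))
    simp only [val, hc] at h2
    linarith [max_eq_right_iff.1 h2]
  · by_cases h1 : φ.val M x - ε / 2 ≤ 0
    · linarith [hN.1]
    obtain ⟨c, q, hq, -, hc⟩ := exists_const (τ := τ) n m
      (r := φ.val M x - ε / 2) ⟨by linarith, by linarith [hM.2]⟩
    rw [abs_le] at hq
    have h2 := h (.monus c φ) (by
      simp only [val, hc]
      exact max_eq_right (by linarith))
    simp only [val, hc] at h2
    linarith [max_eq_right_iff.1 h2]

/-- This uses `min a b = a ∸ (a ∸ b)` and `max a b = 1 - min (1 - a) (1 - b)`. -/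
theorem CFormula.exists_max {n : ℕ} (φ ψ : CFormula τ n) :
    ∃ χ : CFormula τ n, ∀ (M : CStructure τ) (x : Fin n → M),
      χ.val M x = max (φ.val M x) (ψ.val M x) := by
  refine ⟨.monus .one (.monus (.monus .one φ) (.monus (.monus .one φ) (.monus .one ψ))),
    fun M x => ?_⟩
  have h1 := φ.val_mem M x
  have h2 := ψ.val_mem M x
  simp only [val]
  rw [max_eq_left (sub_nonneg.2 h1.2), max_eq_left (sub_nonneg.2 h2.2)]
  rcases le_total (φ.val M x) (ψ.val M x) with h | h
  · rw [max_eq_right h,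
      max_eq_left (a := 1 - φ.val M x - (1 - ψ.val M x)) (by linarith),
      max_eq_left (a := 1 - φ.val M x - (1 - φ.val M x - (1 - ψ.val M x))) (by linarith [h2.2]),
      max_eq_left (by linarith [h2.1])]
    ring
  · rw [max_eq_left h, max_eq_right (a := 1 - φ.val M x - (1 - ψ.val M x)) (by linarith),
      max_eq_left (a := 1 - φ.val M x - 0) (by linarith [h1.2]), max_eq_left (by linarith [h1.1])]
    ring

theorem CFormula.exists_finset_max {n : ℕ} {κ : Type*} (s : Finset κ) (f : κ → CFormula τ n) :
    ∃ χ : CFormula τ n, ∀ (M : CStructure τ) (x : Fin n → M) (ε : ℝ), 0 ≤ ε →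
      (χ.val M x ≤ ε ↔ ∀ k ∈ s, (f k).val M x ≤ ε) := by
  classical
  induction s using Finset.induction_on with
  | empty => exact ⟨.zero, fun M x ε hε => by simpa [val] using hε⟩
  | insert k s hk ih =>
    obtain ⟨χ, hχ⟩ := ih
    obtain ⟨χ', hχ'⟩ := exists_max (f k) χ
    refine ⟨χ', fun M x ε hε => ?_⟩
    rw [hχ', max_le_iff, hχ M x ε hε, Finset.forall_mem_insert]

/-- The infima may fail to be attained, so witnesses come with an error, which is split evenly
between the innermost quantifier and the others. -/
theorem CFormula.exists_infs {k : ℕ} : ∀ (m : ℕ) (φ : CFormula τ (k + m)),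
    ∃ χ : CFormula τ k, ∀ (M : CStructure τ) (x : Fin k → M),
      (∀ y : Fin m → M, χ.val M x ≤ φ.val M (Fin.append x y)) ∧
      ∀ ε > 0, ∃ y : Fin m → M, φ.val M (Fin.append x y) < χ.val M x + ε
  | 0, φ => by
    have h (M : CStructure τ) (x : Fin k → M) (y : Fin 0 → M) : Fin.append x y = x :=
      (congrArg _ (Subsingleton.elim y Fin.elim0)).trans (Fin.append_elim0 x)
    refine ⟨φ, fun M x => ⟨fun y => by rw [h], fun ε hε => ⟨Fin.elim0, ?_⟩⟩⟩
    rw [h]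
    exact lt_add_of_pos_right _ hε
  | m + 1, φ => by
    have hs (M : CStructure τ) (x : Fin k → M) (y : Fin m → M) (a : M) :
      (Fin.append x (Fin.snoc y a : Fin (m + 1) → M) : Fin (k + (m + 1)) → M) =
        (Fin.snoc (Fin.append x y) a : Fin (k + m + 1) → M) := Fin.append_snoc x y a
    obtain ⟨χ, hχ⟩ := exists_infs m (CFormula.inf (n := k + m) φ)
    refine ⟨χ, fun M x => ⟨fun y => ?_, fun ε hε => ?_⟩⟩
    · rw [← Fin.snoc_init_self y, hs]
      exact ((hχ M x).1 _).trans ((isGLB_val_inf M (n := k + m) φ _).1 ⟨_, rfl⟩)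
    · obtain ⟨y, hy⟩ := (hχ M x).2 (ε / 2) (half_pos hε)
      obtain ⟨_, ⟨a, rfl⟩, -, ha⟩ := (isGLB_val_inf M (n := k + m) φ
        (Fin.append x y)).exists_between (lt_add_of_pos_right _ (half_pos hε))
      refine ⟨Fin.snoc y a, ?_⟩
      rw [hs]
      linarith

end Combinations

/-! ## Elementary amalgamation -/

section Amalgamation

open Filter Topology

variable {τ : CLanguage.{u}} {M₁ M₂ : CStructure τ} {X : Type w} {e₁ : X → M₁} {e₂ : X → M₂}

/-- Points named by parameters are kept apart from the rest: the former have prescribed images, the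
latter will be quantified away. Injectivity of `y` makes a map on its entries well defined. -/
theorem exists_finite_enumeration (e : X → M₁) (F : Finset M₁) :
    ∃ (k m : ℕ) (p : Fin k → X) (y : Fin m → M₁), Function.Injective y ∧
      (∀ j, y j ∉ range e) ∧ ∀ a ∈ F, a ∈ range (Fin.append (e ∘ p) y) := by
  classical
  let F₁ := F.filter (· ∈ range e)
  let F₂ := F.filter (· ∉ range e)
  have h1 (j : Fin F₁.card) : ∃ c, e c = F₁.equivFin.symm j :=
    (Finset.mem_filter.1 (F₁.equivFin.symm j).2).2
  choose p hp using h1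
  refine ⟨F₁.card, F₂.card, p, fun j => F₂.equivFin.symm j,
    Subtype.val_injective.comp F₂.equivFin.symm.injective,
    fun j => (Finset.mem_filter.1 (F₂.equivFin.symm j).2).2, fun a ha => ?_⟩
  by_cases hae : a ∈ range e
  · refine ⟨Fin.castAdd _ (F₁.equivFin ⟨a, Finset.mem_filter.2 ⟨ha, hae⟩⟩), ?_⟩
    rw [Fin.append_left, Function.comp_apply, hp, Equiv.symm_apply_apply]
  · refine ⟨Fin.natAdd _ (F₂.equivFin ⟨a, Finset.mem_filter.2 ⟨ha, hae⟩⟩), ?_⟩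
    rw [Fin.append_right, Equiv.symm_apply_apply]

/-- The maximum of the finitely many conditions vanishes at the named and unnamed points together.
Its infimum over the unnamed points is a formula about the parameters alone, so it vanishes in `M₂`
too, and an approximate witness there supplies the images of the unnamed points. -/
theorem exists_approximate_map
    (h : ∀ {n} (φ : CFormula τ n) (x : Fin n → X), φ.val M₁ (e₁ ∘ x) = φ.val M₂ (e₂ ∘ x))
    (s : Finset (CCondition τ M₁)) (hs : ∀ c ∈ s, c.2.1.val M₁ c.2.2 = 0) {ε : ℝ} (hε : 0 < ε) :
    ∃ g : M₁ → M₂, (∀ c, g (e₁ c) = e₂ c) ∧ ∀ c ∈ s, c.2.1.val M₂ (g ∘ c.2.2) ≤ ε := by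
  classical
  obtain ⟨k, m, p, y, hy, hye, hF⟩ := exists_finite_enumeration e₁
    (s.biUnion fun c => Finset.univ.image c.2.2)
  have hidx (c : s) (j : Fin c.1.1) : ∃ l, Fin.append (e₁ ∘ p) y l = c.1.2.2 j :=
    hF _ (Finset.mem_biUnion.2 ⟨c, c.2, Finset.mem_image_of_mem _ (Finset.mem_univ j)⟩)
  choose idx hidx using hidx
  obtain ⟨χ, hχ⟩ := CFormula.exists_finset_max Finset.univ
    fun c : s => c.1.2.1.subst fun j => (.var (idx c j) : τ.funLang.Term (Fin (k + m)))
  obtain ⟨θ, hθ⟩ := CFormula.exists_infs m χ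
  have h1 : θ.val M₂ (e₂ ∘ p) ≤ 0 := by
    rw [← h]
    refine ((hθ M₁ _).1 y).trans ((hχ M₁ _ 0 le_rfl).2 fun c _ => ?_)
    simp only [CFormula.val_subst, Term.realize_var, hidx]
    exact (hs c.1 c.2).le
  obtain ⟨y', hy'⟩ := (hθ M₂ (e₂ ∘ p)).2 ε hε
  have h2 := (hχ M₂ (Fin.append (e₂ ∘ p) y') ε hε.le).1 (by linarith)
  -- Equal parameters in `M₁` are equal in `M₂`, since the formula `d` is among those that agree.
  have hwd (c c' : X) (hc : e₁ c = e₁ c') : e₂ c = e₂ c' := by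
    have h3 : dist (e₁ c) (e₁ c') = dist (e₂ c) (e₂ c') := h dF ![c, c']
    rwa [hc, dist_self, eq_comm, dist_eq_zero] at h3
  let g : M₁ → M₂ := fun a =>
    if ha : ∃ c, e₁ c = a then e₂ ha.choose
    else if ha : ∃ j, y j = a then y' ha.choose else Classical.arbitrary M₂
  have hg (c : X) : g (e₁ c) = e₂ c := by
    have ha : ∃ c', e₁ c' = e₁ c := ⟨c, rfl⟩
    simp only [g, dif_pos ha]
    exact hwd _ _ ha.choose_spec
  have hgy (j : Fin m) : g (y j) = y' j := by
    have ha : ∃ j', y j' = y j := ⟨j, rfl⟩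
    have hn : ¬ ∃ c, e₁ c = y j := hye j
    simp only [g, dif_neg hn, dif_pos ha]
    exact congrArg y' (hy ha.choose_spec)
  have hgl (l : Fin (k + m)) : g (Fin.append (e₁ ∘ p) y l) = Fin.append (e₂ ∘ p) y' l := by
    refine Fin.addCases (fun j => ?_) (fun j => ?_) l
    · simp [hg]
    · simp only [Fin.append_right, hgy]
  refine ⟨g, hg, fun c hc => ?_⟩
  have h3 := h2 ⟨c, hc⟩ (Finset.mem_univ _)
  simp only [CFormula.val_subst, Term.realize_var, ← hgl, hidx] at h3
  exact h3

/-- The indices are pairs of a finite set of zero conditions of `M₁` and a tolerance `1 / (m + 1)`,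
each with its approximate map. In an ultrapower of `M₂` these maps combine into one that preserves
every zero condition exactly, hence all values; `M₂` embeds diagonally. On parameters every
approximate map takes the prescribed value, so the two embeddings agree there. -/
theorem exists_elementary_amalgam
    (h : ∀ {n} (φ : CFormula τ n) (x : Fin n → X), φ.val M₁ (e₁ ∘ x) = φ.val M₂ (e₂ ∘ x)) :
    ∃ (N : CStructure τ) (h₁ : M₁ → N) (h₂ : M₂ → N), IsElementary h₁ ∧ IsElementary h₂ ∧
      ∀ c, h₁ (e₁ c) = h₂ (e₂ c) := by
  classical
  let I := Finset {c : CCondition τ M₁ // c.2.1.val M₁ c.2.2 = 0} × ULift.{u} ℕ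
  have hg (i : I) := exists_approximate_map h (i.1.image Subtype.val)
    (fun c hc => by
      obtain ⟨c, -, rfl⟩ := Finset.mem_image.1 hc
      exact c.2) (ε := 1 / ((i.2.down : ℝ) + 1)) (by positivity)
  choose g hge hg using hg
  obtain ⟨N, ι, hN⟩ := exists_ultrapower M₂ (Ultrafilter.of (atTop : Filter I))
  refine ⟨N, fun a => ι fun i => g i a, fun b => ι fun _ => b, fun n φ x => ?_, fun n φ x => ?_,
    fun c => ?_⟩
  · refine CFormula.val_eq_of_forall_eq_zero (fun φ hφ => ?_) φ
    refine le_antisymm (le_of_forall_sub_nat fun m => ?_) (φ.val_mem N _).1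
    rw [sub_le_iff_le_add, zero_add]
    refine le_of_tendsto (hN φ fun j i => g i (x j)) ((Ultrafilter.of_le _) ?_)
    -- From this index on, the condition belongs to the finite set and the tolerance is at most `1 /
    -- (m + 1)`.
    filter_upwards [eventually_ge_atTop (({⟨⟨n, φ, x⟩, hφ⟩}, ⟨m⟩) : I)] with i hi
    refine (hg i ⟨n, φ, x⟩ (Finset.mem_image.2 ⟨⟨⟨n, φ, x⟩, hφ⟩, hi.1 (by simp), rfl⟩)).trans ?_
    have h3 : (m : ℝ) ≤ i.2.down := by exact_mod_cast (show m ≤ i.2.down from hi.2)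
    exact one_div_le_one_div_of_le (by positivity) (by linarith)
  · exact tendsto_nhds_unique (hN φ fun j _ => x j) tendsto_const_nhds
  · simp only [hge]

end Amalgamation


/-! ## Completions of discrete structures -/

section Completion

variable {τ : CLanguage.{u}}

/-- The subset `S` can only be the range of `i`. This form makes completions accessible to the
calculus of valuations. -/
theorem isCompletion_iff {A : Type u} [τ.plus.Structure A] {M : CStructure τ} {i : A → M} :
    IsCompletion A M i ↔ DenseRange i ∧
      (∀ {n} (F : τ.Func n) (x : Fin n → A),
        i (Structure.funMap (L := τ.funLang) F x) = M.func F (i ∘ x)) ∧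
      IsPlusVal A (fun _ φ x => φ.val M (i ∘ x)) := by
  constructor
  · rintro ⟨S, hS, e, he⟩
    let : τ.plus.Structure S := discretization M S hS
    have hi : i = Subtype.val ∘ e := funext he
    have hd : DenseRange i := by
      have : range i = S := by
        rw [hi, range_comp, e.surjective.range_eq, image_univ, Subtype.range_coe]
      rw [DenseRange, this]
      exact hS.1
    have hf {n} (F : τ.Func n) (x : Fin n → A) :
        i (Structure.funMap (L := τ.funLang) F x) = M.func F (i ∘ x) := by
      rw [hi]
      exact congrArg Subtype.val (e.map_fun (F : τ.plus.Functions n) x)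
    refine ⟨hd, hf, isVal_of_denseRange hd hf, fun φ r x => ?_, fun φ r x => ?_, fun a b h => ?_⟩
    · rw [hi]
      exact (e.map_rel (PlusRel.ge φ r : τ.plus.Relations _) x).symm
    · rw [hi]
      exact (e.map_rel (PlusRel.le φ r : τ.plus.Relations _) x).symm
    · have h1 : i a = i b := dist_eq_zero.1 h
      rw [he, he] at h1
      exact e.injective (Subtype.val_injective h1)
  · rintro ⟨hd, hf, hv⟩
    have hinj : Function.Injective i := fun a b hab => hv.sep a b (dist_eq_zero.2 hab)
    have hS : NicelyDense M (range i) := by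
      refine ⟨hd, fun F x hx => ?_⟩
      choose y hy using hx
      exact ⟨_, (hf F y).trans (congrArg _ (funext hy))⟩
    refine ⟨range i, hS, ?_⟩
    let : τ.plus.Structure (range i) := discretization M (range i) hS
    refine ⟨{ toEquiv := Equiv.ofInjective i hinj, map_fun' := ?_, map_rel' := ?_ }, fun a => rfl⟩
    · intro n F x
      exact Subtype.ext (hf F x)
    · intro n R x
      cases R with
      | ge φ r => exact (hv.ge φ r x).symm
      | le φ r => exact (hv.le φ r x).symm

theorem IsCompletion.pval_eq {A : Type u} [τ.plus.Structure A] {M : CStructure τ} {i : A → M}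
    (h : IsCompletion A M i) {n : ℕ} (φ : CFormula τ n) (x : Fin n → A) :
    pval A n φ x = φ.val M (i ∘ x) := by
  rw [← (isCompletion_iff.1 h).2.2.eq_pval]

/-- The discrete structure on a whole continuous structure. -/
@[reducible] def plusOf (M : CStructure τ) : τ.plus.Structure M where
  funMap := fun F x => M.func F x
  RelMap := fun R x => match R with
    | PlusRel.ge φ r => ((r : ℚ) : ℝ) ≤ φ.val M x
    | PlusRel.le φ r => φ.val M x ≤ ((r : ℚ) : ℝ)

theorem isCompletion_plusOf (M : CStructure τ) :
    letI := plusOf M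
    IsCompletion M M id := by
  let := plusOf M
  rw [isCompletion_iff]
  have hd : DenseRange (id : M → M) := denseRange_id
  exact ⟨hd, fun F x => rfl,
    @isVal_of_denseRange τ M M (plusFunStructure τ M) id hd (fun F x => rfl), fun φ r x => Iff.rfl,
    fun φ r x => Iff.rfl, fun a b h => dist_eq_zero.1 h⟩

theorem mem_modClass_iff {T : CTheory τ} {A : Type u} [τ.plus.Structure A] :
    (modClass (TStar T)).Mem A ↔
      Nonempty A ∧ IsPlusVal A (pval A : Valuation τ A) ∧ ∀ φ ∈ T, pval A 0 φ Fin.elim0 = 0 := by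
  constructor
  · rintro ⟨hA, h⟩
    have hv := InfModels.isPlusVal (A := A) fun σ hσ => h σ (.inl hσ)
    refine ⟨hA, hv, fun φ hφ => ?_⟩
    have h1 := h _ (.inr ⟨φ, hφ, rfl⟩)
    rw [realize_leF hv.mem hv.le, realize_vars, Rat.cast_zero] at h1
    exact le_antisymm h1 (hv.mem _ _).1
  · rintro ⟨hA, hv, hT⟩
    refine ⟨hA, ?_⟩
    rintro _ (hσ | ⟨φ, hφ, rfl⟩)
    · exact hv.infModels _ hσ
    · rw [realize_leF hv.mem hv.le, realize_vars, Rat.cast_zero, hT φ hφ]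

theorem IsCompletion.mem_iff {T : CTheory τ} {A : Type u} [τ.plus.Structure A] {M : CStructure τ}
    {i : A → M} (h : IsCompletion A M i) : (modClass (TStar T)).Mem A ↔ CModels M T := by
  have hv := (isCompletion_iff.1 h).2.2
  have h0 (φ : CFormula τ 0) : pval A 0 φ Fin.elim0 = φ.val M Fin.elim0 := by
    rw [h.pval_eq, Subsingleton.elim (i ∘ Fin.elim0) Fin.elim0]
  rw [mem_modClass_iff, ← hv.eq_pval]
  have hA : Nonempty A := (isCompletion_iff.1 h).1.nonempty
  refine ⟨fun hm φ hφ => ?_, fun hm => ⟨hA, hv, fun φ hφ => ?_⟩⟩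
  · rw [← h0, ← hv.eq_pval]
    exact hm.2.2 φ hφ
  · have := h0 φ
    rw [← hv.eq_pval] at this
    exact this.trans (hm φ hφ)

theorem exists_isCompletion {T : CTheory τ} {A : Type u} [τ.plus.Structure A]
    (h : (modClass (TStar T)).Mem A) :
    ∃ (M : CStructure τ) (i : A → M), CModels M T ∧ IsCompletion A M i := by
  obtain ⟨hA, hv, -⟩ := mem_modClass_iff.1 h
  obtain ⟨M, i, hi, hf, hval⟩ := hv.exists_completion
  have hc : IsCompletion A M i := by
    refine isCompletion_iff.2 ⟨hi, hf, ?_⟩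
    convert hv using 1
    ext n φ x
    exact hval φ x
  exact ⟨M, i, hc.mem_iff.1 h, hc⟩

theorem isCompletion_discretization {M : CStructure τ} {S : Set M} (hS : NicelyDense M S) :
    letI : τ.plus.Structure S := discretization M S hS
    IsCompletion S M Subtype.val := by
  let : τ.plus.Structure S := discretization M S hS
  exact ⟨S, hS, Language.Equiv.refl _ _, fun _ => rfl⟩

/-- The relations of `τ⁺` compare values with rationals, so preserving values preserves and reflects
them. -/
theorem exists_embedding_of_isElementary {A A' : Type u} [τ.plus.Structure A] [τ.plus.Structure A']
    {M N : CStructure τ} {i : A → M} {j : A' → N} (hi : IsCompletion A M i)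
    (hj : IsCompletion A' N j) {h : M → N} (hh : IsElementary h) (g : A → A')
    (hg : ∀ a, j (g a) = h (i a)) : ∃ f : A ↪[τ.plus] A', ∀ a, f a = g a := by
  obtain ⟨-, hfi, hvi⟩ := isCompletion_iff.1 hi
  obtain ⟨-, hfj, hvj⟩ := isCompletion_iff.1 hj
  have hjg : j ∘ g = h ∘ i := funext hg
  have hinj {a b : A'} (hab : j a = j b) : a = b := hvj.sep a b (dist_eq_zero.2 hab)
  have hval {n} (φ : CFormula τ n) (x : Fin n → A) :
      φ.val N (j ∘ g ∘ x) = φ.val M (i ∘ x) := by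
    rw [← Function.comp_assoc, hjg, Function.comp_assoc, hh]
  refine ⟨{ toFun := g, inj' := ?_, map_fun' := ?_, map_rel' := ?_ }, fun a => rfl⟩
  · intro a b hab
    refine hvi.sep a b (dist_eq_zero.2 (hh.isometry.injective ?_))
    change h (i a) = h (i b)
    rw [← hg, ← hg, hab]
  · intro n F x
    refine hinj (Eq.trans ?_ (hfj F (g ∘ x)).symm)
    rw [hg]
    refine (congrArg h (hfi F x)).trans ((hh.map_func F _).trans ?_)
    exact congrArg (N.func F) (funext fun k => (hg (x k)).symm)
  · intro n R x
    cases R with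
    | ge φ r =>
      refine (hvj.ge φ r (g ∘ x)).trans (Iff.trans ?_ (hvi.ge φ r x).symm)
      simp only [hval]
    | le φ r =>
      refine (hvj.le φ r (g ∘ x)).trans (Iff.trans ?_ (hvi.le φ r x).symm)
      simp only [hval]

end Completion

/-! ## Embeddings and substructures -/

section Embedding

variable {τ : CLanguage.{u}} {A N : Type u} [τ.plus.Structure A] [τ.plus.Structure N]

theorem relMap_embedding (f : A ↪[τ.plus] N) {n : ℕ} (R : PlusRel τ n) (x : Fin n → A) :
    Structure.RelMap (L := τ.plus) R (f ∘ x) ↔ Structure.RelMap (L := τ.plus) R x :=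
  f.map_rel (R : τ.plus.Relations n) x

/-- The atomic relations already decide all values, those of quantified formulas included;
substructure thus acts as elementary substructure. -/
theorem pval_embedding (f : A ↪[τ.plus] N) {n : ℕ} (φ : CFormula τ n) (x : Fin n → A) :
    pval N n φ (f ∘ x) = pval A n φ x := by
  simp only [pval, relMap_embedding]

theorem realize_embedding (f : A ↪[τ.plus] N) {n : ℕ} (t : τ.funLang.Term (Fin n))
    (x : Fin n → A) : t.realize (f ∘ x) = f (t.realize x) := by
  induction t with
  | var k => rfl
  | func F ts ih =>
    refine Eq.trans ?_ (f.map_fun (F : τ.plus.Functions _) _).symm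
    exact congrArg (Structure.funMap (L := τ.plus) F) (funext ih)

theorem pval_pair (f : A ↪[τ.plus] N) (a b : A) :
    pval N 2 (dF : CFormula τ 2) ![f a, f b] = pval A 2 (dF : CFormula τ 2) ![a, b] := by
  rw [← pval_embedding f]
  congr 1
  ext i
  fin_cases i <;> rfl

theorem map_func_embedding (f : A ↪[τ.plus] N) {n : ℕ} (F : τ.Func n) (x : Fin n → A) :
    f (Structure.funMap (L := τ.funLang) F x) = Structure.funMap (L := τ.funLang) F (f ∘ x) :=
  f.map_fun (F : τ.plus.Functions n) x

/-- Every clause but those for sup and inf involves finitely many elements. For sup, a structure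
containing `x` and `a` shows that the value is an upper bound; it is the least one because any
structure containing `x` computes it from fewer instances. -/
theorem isPlusVal_of_local
    (h : ∀ {n} (x : Fin n → N), ∃ (A : Type u) (_ : τ.plus.Structure A) (f : A ↪[τ.plus] N)
      (y : Fin n → A), IsPlusVal A (pval A : Valuation τ A) ∧ f ∘ y = x) :
    IsPlusVal N (pval N : Valuation τ N) := by
  have pair (a b : N) : ∃ (A : Type u) (_ : τ.plus.Structure A) (f : A ↪[τ.plus] N)
      (a' b' : A), IsPlusVal A (pval A : Valuation τ A) ∧ f a' = a ∧ f b' = b := by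
    obtain ⟨A, _, f, y, hA, hy⟩ := h ![a, b]
    exact ⟨A, _, f, y 0, y 1, hA, congrFun hy 0, congrFun hy 1⟩
  have two {n} (x y : Fin n → N) : ∃ (A : Type u) (_ : τ.plus.Structure A) (f : A ↪[τ.plus] N)
      (x' y' : Fin n → A), IsPlusVal A (pval A : Valuation τ A) ∧ f ∘ x' = x ∧ f ∘ y' = y := by
    obtain ⟨A, _, f, z, hA, hz⟩ := h (Fin.append x y)
    refine ⟨A, _, f, fun i => z (Fin.castAdd n i), fun i => z (Fin.natAdd n i), hA, ?_, ?_⟩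
    · ext i
      exact (congrFun hz _).trans (Fin.append_left x y i)
    · ext i
      exact (congrFun hz _).trans (Fin.append_right x y i)
  have snoc {n} (x : Fin n → N) (a : N) : ∃ (A : Type u) (_ : τ.plus.Structure A)
      (f : A ↪[τ.plus] N) (x' : Fin n → A) (a' : A), IsPlusVal A (pval A : Valuation τ A) ∧
        f ∘ x' = x ∧ f a' = a := by
    obtain ⟨A, _, f, z, hA, hz⟩ := h (Fin.snoc x a : Fin (n + 1) → N)
    refine ⟨A, _, f, fun i => z i.castSucc, z (Fin.last n), hA, ?_, ?_⟩
    · ext i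
      exact (congrFun hz _).trans (Fin.snoc_castSucc (α := fun _ => N) _ _ _)
    · exact (congrFun hz _).trans (Fin.snoc_last (α := fun _ => N) _ _)
  refine ⟨⟨?_, ?_, ?_, ?_, ?_, ?_, ?_, ?_, ?_, ?_, ?_, ?_, ?_⟩, ?_, ?_, ?_⟩
  · intro n φ x
    obtain ⟨A, _, f, x, hA, rfl⟩ := h x
    rw [pval_embedding]
    exact hA.mem φ x
  · intro n x
    obtain ⟨A, _, f, x, hA, rfl⟩ := h x
    rw [pval_embedding, hA.zero]
  · intro n x
    obtain ⟨A, _, f, x, hA, rfl⟩ := h x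
    rw [pval_embedding, hA.one]
  · intro n φ x
    obtain ⟨A, _, f, x, hA, rfl⟩ := h x
    rw [pval_embedding, pval_embedding, hA.half]
  · intro n φ ψ x
    obtain ⟨A, _, f, x, hA, rfl⟩ := h x
    rw [pval_embedding, pval_embedding, pval_embedding, hA.monus]
  · intro n φ x
    constructor
    · rintro _ ⟨a, rfl⟩
      obtain ⟨A, _, f, x, a, hA, rfl, rfl⟩ := snoc x a
      simp only [← Fin.comp_snoc]
      rw [pval_embedding, pval_embedding]
      exact (hA.sup φ x).1 ⟨a, rfl⟩
    · intro b hb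
      obtain ⟨A, _, f, x, hA, rfl⟩ := h x
      rw [pval_embedding, isLUB_le_iff (hA.sup φ x)]
      rintro _ ⟨a, rfl⟩
      have := hb ⟨f a, rfl⟩
      simp only [← Fin.comp_snoc] at this
      rwa [pval_embedding] at this
  · intro n φ x
    constructor
    · rintro _ ⟨a, rfl⟩
      obtain ⟨A, _, f, x, a, hA, rfl, rfl⟩ := snoc x a
      simp only [← Fin.comp_snoc]
      rw [pval_embedding, pval_embedding]
      exact (hA.inf φ x).1 ⟨a, rfl⟩
    · intro b hb
      obtain ⟨A, _, f, x, hA, rfl⟩ := h x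
      rw [pval_embedding, le_isGLB_iff (hA.inf φ x)]
      rintro _ ⟨a, rfl⟩
      have := hb ⟨f a, rfl⟩
      simp only [← Fin.comp_snoc] at this
      rwa [pval_embedding] at this
  · intro k n φ t x
    obtain ⟨A, _, f, x, hA, rfl⟩ := h x
    simp only [realize_embedding]
    rw [pval_embedding, hA.subst, ← pval_embedding f]
    rfl
  · intro a
    obtain ⟨A, _, f, a, b, hA, rfl, -⟩ := pair a a
    rw [pval_pair, hA.dist_self]
  · intro a b
    obtain ⟨A, _, f, a, b, hA, rfl, rfl⟩ := pair a b
    rw [pval_pair, pval_pair, hA.dist_comm]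
  · intro a b c
    obtain ⟨A, _, f, y, hA, hy⟩ := h ![a, b, c]
    have h0 : f (y 0) = a := congrFun hy 0
    have h1 : f (y 1) = b := congrFun hy 1
    have h2 : f (y 2) = c := congrFun hy 2
    rw [← h0, ← h1, ← h2, pval_pair, pval_pair, pval_pair]
    exact hA.dist_triangle _ _ _
  · intro n F r h0 h1 x y hxy
    obtain ⟨A, _, f, x, y, hA, rfl, rfl⟩ := two x y
    rw [← map_func_embedding, ← map_func_embedding, pval_pair]
    refine hA.func_unif F r h0 h1 x y fun i => ?_
    rw [← pval_pair f]
    exact hxy i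
  · intro n R r h0 h1 x y hxy
    obtain ⟨A, _, f, x, y, hA, rfl, rfl⟩ := two x y
    rw [pval_embedding, pval_embedding]
    refine hA.rel_unif R r h0 h1 x y fun i => ?_
    rw [← pval_pair f]
    exact hxy i
  · intro n φ r x
    obtain ⟨A, _, f, x, hA, rfl⟩ := h x
    rw [pval_embedding, relMap_embedding, hA.ge]
  · intro n φ r x
    obtain ⟨A, _, f, x, hA, rfl⟩ := h x
    rw [pval_embedding, relMap_embedding, hA.le]
  · intro a b hab
    obtain ⟨A, _, f, a, b, hA, rfl, rfl⟩ := pair a b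
    rw [pval_pair] at hab
    rw [hA.sep a b hab]

/-- This is a Tarski–Vaught test. Only witnesses for single relations with rational thresholds are
required, which suffices because a sup or inf is determined by the thresholds that its instances
pass. -/
theorem isPlusVal_of_embedding [Nonempty A] (f : A ↪[τ.plus] N)
    (hN : IsPlusVal N (pval N : Valuation τ N))
    (hex : ∀ {n} (R : PlusRel τ (n + 1)) (x : Fin n → A),
      (∃ b : N, Structure.RelMap (L := τ.plus) R (Fin.snoc (f ∘ x) b : Fin (n + 1) → N)) →
      ∃ a : A, Structure.RelMap (L := τ.plus) R (Fin.snoc x a : Fin (n + 1) → A)) :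
    IsPlusVal A (pval A : Valuation τ A) := by
  have e {n} (φ : CFormula τ n) (x : Fin n → A) : pval A n φ x = pval N n φ (f ∘ x) :=
    (pval_embedding f φ x).symm
  have ge {n} (φ : CFormula τ n) (r : QUnit) (x : Fin n → A) :
      Structure.RelMap (L := τ.plus) (PlusRel.ge φ r) x ↔ ((r : ℚ) : ℝ) ≤ pval A n φ x := by
    rw [e, ← hN.ge, relMap_embedding]
  have le {n} (φ : CFormula τ n) (r : QUnit) (x : Fin n → A) :
      Structure.RelMap (L := τ.plus) (PlusRel.le φ r) x ↔ pval A n φ x ≤ ((r : ℚ) : ℝ) := by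
    rw [e, ← hN.le, relMap_embedding]
  have mem {n} (φ : CFormula τ n) (x : Fin n → A) : pval A n φ x ∈ Icc (0 : ℝ) 1 := by
    rw [e]
    exact hN.mem _ _
  refine ⟨⟨mem, ?_, ?_, ?_, ?_, ?_, ?_, ?_, ?_, ?_, ?_, ?_, ?_⟩, ge, le, ?_⟩
  · intro n x
    rw [e, hN.zero]
  · intro n x
    rw [e, hN.one]
  · intro n φ x
    rw [e, e, hN.half]
  · intro n φ ψ x
    rw [e, e, e, hN.monus]
  · intro n φ x
    have hl := hN.sup φ (f ∘ x)
    constructor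
    · rintro _ ⟨a, rfl⟩
      simp only [e, Fin.comp_snoc]
      exact hl.1 ⟨f a, rfl⟩
    · intro b hb
      rw [e]
      have hb0 : 0 ≤ b := (mem φ _).1.trans (hb ⟨Classical.arbitrary A, rfl⟩)
      refine le_of_forall_lt_imp_le_of_dense fun c hc => ?_
      by_cases hc0 : c < 0
      · exact hc0.le.trans hb0
      -- A rational `s` in `[c, d]` turns the existence of an instance above `d` into the existence
      -- of a witness for one relation of `τ⁺`.
      obtain ⟨d, hcd, hd⟩ := exists_between hc
      obtain ⟨s, hs1, hs2⟩ := exists_qunit_between hcd (hc.le.trans (hN.mem _ _).2)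
        ((not_lt.1 hc0).trans hcd.le)
      obtain ⟨_, ⟨a, rfl⟩, ha, -⟩ := hl.exists_between hd
      obtain ⟨a', ha'⟩ := hex (.ge φ s) x ⟨a, (hN.ge φ s _).2 (hs2.trans ha.le)⟩
      exact hs1.trans (((ge φ s _).1 ha').trans (hb ⟨a', rfl⟩))
  · intro n φ x
    have hl := hN.inf φ (f ∘ x)
    constructor
    · rintro _ ⟨a, rfl⟩
      simp only [e, Fin.comp_snoc]
      exact hl.1 ⟨f a, rfl⟩
    · intro b hb
      rw [e]
      have hb1 : b ≤ 1 := (hb ⟨Classical.arbitrary A, rfl⟩).trans (mem φ _).2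
      refine le_of_forall_gt_imp_ge_of_dense fun c hc => ?_
      by_cases hc0 : 1 < c
      · exact hb1.trans hc0.le
      obtain ⟨d, hd, hdc⟩ := exists_between hc
      obtain ⟨s, hs1, hs2⟩ := exists_qunit_between hdc (hdc.le.trans (not_lt.1 hc0))
        ((hN.mem _ _).1.trans hc.le)
      obtain ⟨_, ⟨a, rfl⟩, -, ha⟩ := hl.exists_between hd
      obtain ⟨a', ha'⟩ := hex (.le φ s) x ⟨a, (hN.le φ s _).2 (ha.le.trans hs1)⟩
      exact (hb ⟨a', rfl⟩).trans (((le φ s _).1 ha').trans hs2)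
  · intro k n φ t x
    rw [e, hN.subst, e]
    simp only [realize_embedding]
    rfl
  · intro a
    rw [← pval_pair f, hN.dist_self]
  · intro a b
    rw [← pval_pair f, ← pval_pair f, hN.dist_comm]
  · intro a b c
    rw [← pval_pair f, ← pval_pair f, ← pval_pair f]
    exact hN.dist_triangle _ _ _
  · intro n F r h0 h1 x y hxy
    rw [← pval_pair f, map_func_embedding, map_func_embedding]
    refine hN.func_unif F r h0 h1 _ _ fun i => ?_
    have := hxy i
    rwa [← pval_pair f] at this
  · intro n R r h0 h1 x y hxy
    rw [e, e]
    refine hN.rel_unif R r h0 h1 _ _ fun i => ?_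
    have := hxy i
    rwa [← pval_pair f] at this
  · intro a b hab
    rw [← pval_pair f] at hab
    exact f.injective (hN.sep _ _ hab)

end Embedding


/-! ## The class of models as an Abstract Elementary Class -/

section ModClass

variable {L : FirstOrder.Language.{u, u}} {T : Set (InfFormula L 0)}

theorem modClass_mem_of_equiv {M N : Type u} [L.Structure M] [L.Structure N] (e : M ≃[L] N)
    (h : (modClass T).Mem M) : (modClass T).Mem N :=
  ⟨h.1.map e, h.2.of_equiv e⟩

theorem isStrongEmbedding_modClass {M N : Type u} [L.Structure M] [L.Structure N] {f : M ↪[L] N}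
    (hM : (modClass T).Mem M) (hN : (modClass T).Mem N) : (modClass T).IsStrongEmbedding f :=
  ⟨hM, modClass_mem_of_equiv f.equivRange hM, hN⟩

theorem AbstractClass.IsStrongEmbedding.mem_modClass {M N : Type u} [L.Structure M]
    [L.Structure N] {f : M ↪[L] N} (h : (modClass T).IsStrongEmbedding f) : (modClass T).Mem N :=
  h.2.2

theorem map_comap_subtype {M : Type u} [L.Structure M] {R S : L.Substructure M} (h : R ≤ S) :
    (R.comap S.subtype.toHom).map S.subtype.toHom = R := by
  ext x
  simp only [Substructure.mem_map, Substructure.mem_comap]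
  exact ⟨fun ⟨y, hy, hyx⟩ => hyx ▸ hy, fun hx => ⟨⟨x, h hx⟩, hx, rfl⟩⟩

theorem modClass_mem_comap {M : Type u} [L.Structure M] {R S : L.Substructure M} (h : R ≤ S)
    (hR : (modClass T).Mem R) : (modClass T).Mem (R.comap S.subtype.toHom) := by
  have e := S.subtype.substructureEquivMap (R.comap S.subtype.toHom)
  rw [map_comap_subtype h] at e
  exact modClass_mem_of_equiv e.symm hR

end ModClass

section AEC

variable {τ : CLanguage.{u}} {T : CTheory τ}

theorem mem_of_isPlusVal_of_embedding {A N : Type u} [τ.plus.Structure A] [τ.plus.Structure N]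
    (f : A ↪[τ.plus] N) (hA : (modClass (TStar T)).Mem A)
    (hN : IsPlusVal N (pval N : Valuation τ N)) : (modClass (TStar T)).Mem N := by
  obtain ⟨hne, -, hT⟩ := mem_modClass_iff.1 hA
  refine mem_modClass_iff.2 ⟨hne.map f, hN, fun φ hφ => ?_⟩
  rw [Subsingleton.elim Fin.elim0 (f ∘ Fin.elim0), pval_embedding, hT φ hφ]

theorem modClass_mem_of_directed {I : Type u} [LinearOrder I] [Nonempty I] {N : Type u}
    [τ.plus.Structure N] {S : I → τ.plus.Substructure N} (hS : Monotone S)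
    (hc : ∀ x : N, ∃ i, x ∈ S i) (hm : ∀ i, (modClass (TStar T)).Mem (S i)) :
    (modClass (TStar T)).Mem N := by
  obtain ⟨i₀⟩ := ‹Nonempty I›
  refine mem_of_isPlusVal_of_embedding (S i₀).subtype (hm i₀)
    (isPlusVal_of_local fun {n} x => ?_)
  choose g hg using fun k => hc (x k)
  obtain ⟨i, hi⟩ := Finite.exists_le g
  exact ⟨S i, inferInstance, (S i).subtype, fun k => ⟨x k, hS (hi k) (hg k)⟩,
    (mem_modClass_iff.1 (hm i)).2.1, rfl⟩

/-- Although `TStar T` is infinitary, first-order elementarity is enough: the test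
`isPlusVal_of_embedding` only asks about formulas `∃ y, R(x, y)`. -/
theorem modClass_mem_of_elementarySubstructure {N : Type u} [τ.plus.Structure N]
    (S : τ.plus.ElementarySubstructure N) (hN : (modClass (TStar T)).Mem N) :
    (modClass (TStar T)).Mem S := by
  obtain ⟨hne, hv, hT⟩ := mem_modClass_iff.1 hN
  let f : S ↪[τ.plus] N := S.subtype.toEmbedding
  have hS : Nonempty S := by
    have h1 := (S.subtype.map_sentence (Sentence.cardGe τ.plus 1))
    rw [Sentence.realize_cardGe, Sentence.realize_cardGe, Nat.cast_one, Cardinal.one_le_iff_ne_zero,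
      Cardinal.one_le_iff_ne_zero, Cardinal.mk_ne_zero_iff, Cardinal.mk_ne_zero_iff] at h1
    exact h1.2 hne
  have hv' : IsPlusVal S (pval S : Valuation τ S) := by
    refine isPlusVal_of_embedding f hv fun {n} R x hR => ?_
    let R' : τ.plus.Relations (n + 1) := R
    let ψ : τ.plus.BoundedFormula Empty n :=
      (R'.boundedFormula fun i => (Term.var (Sum.inr i) : τ.plus.Term (Empty ⊕ Fin (n + 1)))).ex
    have key := S.subtype.map_boundedFormula ψ Empty.elim x
    simp only [ψ, BoundedFormula.realize_ex, BoundedFormula.realize_rel, Term.realize_var,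
      Sum.elim_inr] at key
    exact key.1 hR
  refine mem_modClass_iff.2 ⟨hS, hv', fun φ hφ => ?_⟩
  rw [← pval_embedding f, Subsingleton.elim (f ∘ Fin.elim0) Fin.elim0, hT φ hφ]

theorem modClass_lowenheim_skolem {N : Type u} [τ.plus.Structure N]
    (hN : (modClass (TStar T)).Mem N) (A : Set N) :
    ∃ S : τ.plus.Substructure N, A ⊆ S ∧ (modClass (TStar T)).Strong N S ∧
      Cardinal.mk S ≤ Cardinal.mk A + max Cardinal.aleph0 τ.plus.card := by
  have h1 : max Cardinal.aleph0 τ.plus.card ≤ Cardinal.mk A + max Cardinal.aleph0 τ.plus.card :=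
    self_le_add_left _ _
  rcases le_total (Cardinal.mk A + max Cardinal.aleph0 τ.plus.card) (Cardinal.mk N) with h | h
  · obtain ⟨S, hAS, hS⟩ := exists_elementarySubstructure_card_eq τ.plus A
      (Cardinal.mk A + max Cardinal.aleph0 τ.plus.card) ((le_max_left _ _).trans h1)
      (by simp) (by simpa using (le_max_right _ _).trans h1) (by simpa using h)
    simp only [Cardinal.lift_id] at hS
    exact ⟨S.toSubstructure, hAS, ⟨modClass_mem_of_elementarySubstructure S hN, hN⟩, hS.le⟩
  · refine ⟨⊤, subset_univ _, ⟨modClass_mem_of_equiv Substructure.topEquiv.symm hN, hN⟩, ?_⟩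
    exact (Cardinal.mk_congr Substructure.topEquiv.toEquiv).trans_le h

theorem isAEC_modClass (T : CTheory τ) : (modClass (TStar T)).IsAEC where
  mem_of_equiv M N _ _ e := modClass_mem_of_equiv e
  strong_of_equiv M N _ _ e S hS :=
    ⟨modClass_mem_of_equiv (e.toEmbedding.substructureEquivMap S) hS.1,
      modClass_mem_of_equiv e hS.2⟩
  mem_of_strong N _ S hS := hS
  refl N _ hN := ⟨modClass_mem_of_equiv Substructure.topEquiv.symm hN, hN⟩
  trans N _ S R hR hS :=
    ⟨modClass_mem_of_equiv (S.subtype.substructureEquivMap R) hR.1, hS.2⟩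
  coherence N _ R S hRS hR hS := ⟨modClass_mem_comap hRS hR.1, hS.1⟩
  chain I _ _ _ N _ S hS hc hm _ :=
    have hN := modClass_mem_of_directed hS hc hm
    ⟨hN, fun i => ⟨hm i, hN⟩⟩
  smooth I _ _ _ M _ S U hS hU _ hm := by
    have hle (i : I) : S i ≤ U := fun x hx => (hU x).2 ⟨i, hx⟩
    obtain ⟨i₀⟩ := ‹Nonempty I›
    have : Nonempty I := ⟨i₀⟩
    -- The chain is viewed inside its union `U`, which reduces smoothness to closure under unions.
    refine ⟨modClass_mem_of_directed (S := fun i => (S i).comap U.subtype.toHom)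
      (fun i j hij x hx => hS hij hx) (fun x => (hU x).1 x.2)
      fun i => modClass_mem_comap (hle i) (hm i).1, (hm i₀).2⟩
  lowenheim_skolem := ⟨max Cardinal.aleph0 τ.plus.card, le_max_left _ _, le_max_right _ _,
    fun _ _ hM A => modClass_lowenheim_skolem hM A⟩

end AEC

/-! ## Amalgamation -/

section Amalgamation

open Filter Topology

variable {τ : CLanguage.{u}} {T : CTheory τ}

theorem IsElementary.cModels {M N : CStructure τ} {h : M → N} (hh : IsElementary h)
    (hM : CModels M T) : CModels N T := fun φ hφ => by
  rw [← hM φ hφ, ← hh, Subsingleton.elim (h ∘ Fin.elim0) Fin.elim0]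

theorem exists_strong_embedding_plusOf {A : Type u} [τ.plus.Structure A]
    (hA : (modClass (TStar T)).Mem A) {M N : CStructure τ} {i : A → M} (hi : IsCompletion A M i)
    {h : M → N} (hh : IsElementary h) :
    letI := plusOf N
    ∃ f : A ↪[τ.plus] N, (modClass (TStar T)).IsStrongEmbedding f ∧ ∀ a, f a = h (i a) := by
  let := plusOf N
  have hN := isCompletion_plusOf N
  obtain ⟨f, hf⟩ := exists_embedding_of_isElementary hi hN hh (fun a => h (i a)) fun a => rfl
  exact ⟨f, isStrongEmbedding_modClass hA
    (hN.mem_iff.2 (hh.cModels (hi.mem_iff.1 hA))), hf⟩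

/-- The amalgam is the whole of a continuous structure, so it needs no further dense subset. The
maps `h₁`, `h₂` are retained because the parameters may lie in the completions outside `A₁` and
`A₂`. -/
theorem exists_strong_amalgam {A₁ A₂ : Type u} [τ.plus.Structure A₁] [τ.plus.Structure A₂]
    (hA₁ : (modClass (TStar T)).Mem A₁) (hA₂ : (modClass (TStar T)).Mem A₂)
    {M₁ M₂ : CStructure τ} {i₁ : A₁ → M₁} {i₂ : A₂ → M₂} (hi₁ : IsCompletion A₁ M₁ i₁)
    (hi₂ : IsCompletion A₂ M₂ i₂) {X : Type w} {e₁ : X → M₁} {e₂ : X → M₂}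
    (h : ∀ {n} (φ : CFormula τ n) (x : Fin n → X), φ.val M₁ (e₁ ∘ x) = φ.val M₂ (e₂ ∘ x)) :
    ∃ (N : Type u) (_ : τ.plus.Structure N) (f₁ : A₁ ↪[τ.plus] N) (f₂ : A₂ ↪[τ.plus] N)
      (h₁ : M₁ → N) (h₂ : M₂ → N), (modClass (TStar T)).IsStrongEmbedding f₁ ∧
        (modClass (TStar T)).IsStrongEmbedding f₂ ∧ (∀ a, f₁ a = h₁ (i₁ a)) ∧
        (∀ a, f₂ a = h₂ (i₂ a)) ∧ ∀ c, h₁ (e₁ c) = h₂ (e₂ c) := by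
  obtain ⟨N, h₁, h₂, hh₁, hh₂, he⟩ := exists_elementary_amalgam h
  let := plusOf N
  obtain ⟨f₁, hf₁, hfh₁⟩ := exists_strong_embedding_plusOf hA₁ hi₁ hh₁
  obtain ⟨f₂, hf₂, hfh₂⟩ := exists_strong_embedding_plusOf hA₂ hi₂ hh₂
  exact ⟨N, inferInstance, f₁, f₂, h₁, h₂, hf₁, hf₂, hfh₁, hfh₂, he⟩

/-- Atomic formulas alone determine `pval`, so equal quantifier-free types give equal values of all
continuous formulas in the completions. -/
theorem amalgamationOverSets_modClass (T : CTheory τ) :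
    (modClass (TStar T)).AmalgamationOverSets := by
  intro A₁ A₂ _ _ hA₁ hA₂ X e₁ e₂ he
  obtain ⟨M₁, i₁, -, hi₁⟩ := exists_isCompletion hA₁
  obtain ⟨M₂, i₂, -, hi₂⟩ := exists_isCompletion hA₂
  have hrel {n} (R : PlusRel τ n) (x : Fin n → X) :
      Structure.RelMap (L := τ.plus) R (e₁ ∘ x) ↔ Structure.RelMap (L := τ.plus) R (e₂ ∘ x) := by
    let R' : τ.plus.Relations n := R
    have h := he (R'.formula fun k => Term.var (x k)) (BoundedFormula.IsAtomic.rel _ _).isQF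
    rw [Formula.realize_rel, Formula.realize_rel] at h
    exact h
  have hval {n} (φ : CFormula τ n) (x : Fin n → X) :
      φ.val M₁ ((i₁ ∘ e₁) ∘ x) = φ.val M₂ ((i₂ ∘ e₂) ∘ x) := by
    rw [Function.comp_assoc, Function.comp_assoc, ← hi₁.pval_eq, ← hi₂.pval_eq]
    simp only [pval, hrel]
  obtain ⟨N, _, f₁, f₂, h₁, h₂, hf₁, hf₂, hfh₁, hfh₂, hN⟩ :=
    exists_strong_amalgam hA₁ hA₂ hi₁ hi₂ hval
  refine ⟨N, _, f₁, f₂, hf₁, hf₂, fun a => ?_⟩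
  rw [hfh₁, hfh₂]
  exact hN a

theorem CTheory.IsComplete.val_eq (hT : T.IsComplete) {M N : CStructure τ} (hM : CModels M T)
    (hN : CModels N T) {n : ℕ} (φ : CFormula τ n) (x : Fin n → Empty) :
    φ.val M (Empty.elim ∘ x) = φ.val N (Empty.elim ∘ x) := by
  cases n with
  | zero =>
    rw [Subsingleton.elim (Empty.elim ∘ x) Fin.elim0, Subsingleton.elim (Empty.elim ∘ x) Fin.elim0]
    exact hT.2 M N hM hN φ
  | succ n => exact (x 0).elim

theorem jointEmbedding_modClass (hT : T.IsComplete) : (modClass (TStar T)).JointEmbedding := by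
  intro A₁ A₂ _ _ hA₁ hA₂
  obtain ⟨M₁, i₁, hM₁, hi₁⟩ := exists_isCompletion hA₁
  obtain ⟨M₂, i₂, hM₂, hi₂⟩ := exists_isCompletion hA₂
  obtain ⟨N, _, f₁, f₂, -, -, hf₁, hf₂, -⟩ :=
    exists_strong_amalgam hA₁ hA₂ hi₁ hi₂ (hT.val_eq hM₁ hM₂)
  exact ⟨N, _, f₁, f₂, hf₁, hf₂⟩

/-- A complete space that is not compact is not totally bounded: for some `ε`, each finite set `F`
has a point `a F` at distance at least `ε` from it. Along an ultrafilter on the finite sets that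
refines `atTop`, the class of `a` stays at distance at least `ε` from every diagonal element. -/
theorem exists_proper_elementary_extension {M : CStructure τ} (hM : ¬ CompactSpace M) :
    ∃ (N : CStructure τ) (h : M → N), IsElementary h ∧ ¬ Function.Surjective h := by
  classical
  have htb : ¬ TotallyBounded (univ : Set M) := fun h =>
    hM ⟨h.isCompact_of_isClosed isClosed_univ⟩
  rw [Metric.totallyBounded_iff] at htb
  push Not at htb
  obtain ⟨ε, hε, h⟩ := htb
  have hfar (F : Finset M) : ∃ a : M, ∀ b ∈ F, ε ≤ dist a b := by
    obtain ⟨a, -, ha⟩ := not_subset.1 (h F F.finite_toSet)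
    simp only [mem_iUnion, not_exists, Metric.mem_ball, not_lt] at ha
    exact ⟨a, fun b hb => ha b hb⟩
  choose a ha using hfar
  obtain ⟨N, ι, hN⟩ := exists_ultrapower M (Ultrafilter.of (atTop : Filter (Finset M)))
  refine ⟨N, fun b => ι fun _ => b,
    fun n φ x => tendsto_nhds_unique (hN φ fun j _ => x j) tendsto_const_nhds, fun hs => ?_⟩
  obtain ⟨b, hb⟩ := hs (ι a)
  have hlim : Tendsto (fun F => dist (a F) b) (Ultrafilter.of (atTop : Filter (Finset M)))
      (𝓝 (dist (ι a) (ι fun _ => b))) := hN dF ![a, fun _ => b]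
  have hle : ε ≤ dist (ι a) (ι fun _ => b) := by
    refine ge_of_tendsto hlim ((Ultrafilter.of_le _) ?_)
    filter_upwards [eventually_ge_atTop ({b} : Finset M)] with F hF
    exact ha F b (hF (Finset.mem_singleton_self b))
  rw [← hb, dist_self] at hle
  linarith

theorem noMaximalModels_modClass (hT : T.IsComplete)
    (h : ∃ M : CStructure τ, CModels M T ∧ ¬ CompactSpace M) :
    (modClass (TStar T)).NoMaximalModels := by
  intro A _ hA
  obtain ⟨M, i, hM, hi⟩ := exists_isCompletion hA
  obtain ⟨M₀, hM₀, hc₀⟩ := h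
  obtain ⟨N, g, hg, hgs⟩ : ∃ (N : CStructure τ) (g : M → N), IsElementary g ∧
      ¬ Function.Surjective g := by
    by_cases hc : CompactSpace M
    -- A compact `M` is embedded together with the non-compact `M₀` in a common `N`. If `M` covered
    -- `N`, then `N` would be compact, and so would `M₀`, which is isometric to a closed subset of
    -- `N`.
    · obtain ⟨N, g, g₀, hg, hg₀, -⟩ := exists_elementary_amalgam (hT.val_eq hM hM₀)
      refine ⟨N, g, hg, fun hs => hc₀ ?_⟩
      have : CompactSpace N := hs.compactSpace hg.isometry.continuous
      exact hg₀.isometry.isClosedEmbedding.compactSpace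
    · exact exists_proper_elementary_extension hc
  let := plusOf N
  obtain ⟨f, hf, hfg⟩ := exists_strong_embedding_plusOf hA hi hg
  refine ⟨N, inferInstance, f, hf, fun hs => hgs fun b => ?_⟩
  obtain ⟨a, rfl⟩ := hs b
  exact ⟨i a, (hfg a).symm⟩

end Amalgamation

/-! ## Galois types -/

section GaloisTypes

variable {τ : CLanguage.{u}} {T : CTheory τ}

theorem exists_isElementary_of_embedding {A A' : Type u} [τ.plus.Structure A]
    [τ.plus.Structure A'] {M N : CStructure τ} {i : A → M} {j : A' → N} (hi : IsCompletion A M i)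
    (hj : IsCompletion A' N j) (f : A ↪[τ.plus] A') :
    ∃ h : M → N, IsElementary h ∧ ∀ a, h (i a) = j (f a) := by
  refine exists_isElementary_of_denseRange (isCompletion_iff.1 hi).1 (j ∘ f) fun φ x => ?_
  rw [← hi.pval_eq, ← pval_embedding f, hj.pval_eq, Function.comp_assoc]

theorem typeOf_eq_of_isElementary {M N : CStructure τ} {h : M → N} (hh : IsElementary h)
    {ι : Type v} {B : Type w} (b : B → M) (a : ι → M) :
    typeOf N (h ∘ b) (h ∘ a) = typeOf M b a := by
  ext ⟨n, φ, x⟩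
  change φ.val N (Sum.elim (h ∘ a) (h ∘ b) ∘ x) = 0 ↔ φ.val M (Sum.elim a b ∘ x) = 0
  rw [← Sum.comp_elim, Function.comp_assoc, hh]

/-- In a completion of the amalgam, the two copies of `M` agree on `C`, hence by continuity on its
closure and on `B`, while the two tuples coincide. Elementary maps preserve types. -/
theorem typeOf_eq_of_atomicEq {A : Type u} [τ.plus.Structure A] {M : CStructure τ} {i : A → M}
    {C : Set A} {B : Set M} (hB : B ⊆ closure (i '' C)) {ι : Type v}
    {t₁ t₂ : (modClass (TStar T)).GaloisTriple A ι} (h : (modClass (TStar T)).AtomicEq C ι t₁ t₂)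
    {N₁ N₂ : CStructure τ} {j₁ : t₁.N → N₁} {j₂ : t₂.N → N₂} (hj₁ : IsCompletion t₁.N N₁ j₁)
    (hj₂ : IsCompletion t₂.N N₂ j₂) {h₁ : M → N₁} {h₂ : M → N₂} (hh₁ : IsElementary h₁)
    (hh₂ : IsElementary h₂) (hi₁ : ∀ x, h₁ (i x) = j₁ (t₁.f x))
    (hi₂ : ∀ x, h₂ (i x) = j₂ (t₂.f x)) :
    typeOf N₁ (fun b : B => h₁ b) (fun k => j₁ (t₁.a k)) =
      typeOf N₂ (fun b : B => h₂ b) (fun k => j₂ (t₂.a k)) := by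
  obtain ⟨N, _, g₁, g₂, hg₁, hg₂, hC, ha⟩ := h
  obtain ⟨P, j, -, hj⟩ := exists_isCompletion hg₁.mem_modClass
  obtain ⟨k₁, hk₁, hkj₁⟩ := exists_isElementary_of_embedding hj₁ hj g₁
  obtain ⟨k₂, hk₂, hkj₂⟩ := exists_isElementary_of_embedding hj₂ hj g₂
  rw [← typeOf_eq_of_isElementary hk₁, ← typeOf_eq_of_isElementary hk₂]
  have hcl : IsClosed {x | k₁ (h₁ x) = k₂ (h₂ x)} :=
    isClosed_eq (hk₁.comp hh₁).isometry.continuous (hk₂.comp hh₂).isometry.continuous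
  have hsub : B ⊆ {x | k₁ (h₁ x) = k₂ (h₂ x)} := by
    refine hB.trans (closure_minimal ?_ hcl)
    rintro _ ⟨c, hc, rfl⟩
    change k₁ (h₁ (i c)) = k₂ (h₂ (i c))
    rw [hi₁, hi₂, hkj₁, hkj₂, hC c hc]
  congr 1
  · exact funext fun b => hsub b.2
  · exact funext fun k => by
      change k₁ (j₁ (t₁.a k)) = k₂ (j₂ (t₂.a k))
      rw [hkj₁, hkj₂, ha]

theorem atomicEq_refl {A : Type u} [τ.plus.Structure A] (C : Set A) {ι : Type v}
    (t : (modClass (TStar T)).GaloisTriple A ι) : (modClass (TStar T)).AtomicEq C ι t t := by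
  have h := isStrongEmbedding_modClass (f := Embedding.refl τ.plus t.N) t.strong.mem_modClass
    t.strong.mem_modClass
  exact ⟨t.N, t.str, Embedding.refl _ _, Embedding.refl _ _, h, h, fun _ _ => rfl, fun _ => rfl⟩

theorem val_eq_of_typeOf_eq {N₁ N₂ : CStructure τ} {ι : Type v} {B : Type w} {b₁ : B → N₁}
    {b₂ : B → N₂} {a₁ : ι → N₁} {a₂ : ι → N₂} (h : typeOf N₁ b₁ a₁ = typeOf N₂ b₂ a₂) {n : ℕ}
    (φ : CFormula τ n) (x : Fin n → ι ⊕ B) :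
    φ.val N₁ (Sum.elim a₁ b₁ ∘ x) = φ.val N₂ (Sum.elim a₂ b₂ ∘ x) := by
  refine (CFormula.val_eq_of_forall_eq_zero (fun ψ hψ => ?_) φ).symm
  have h1 : (⟨n, ψ, x⟩ : CCondition τ (ι ⊕ B)) ∈ typeOf N₁ b₁ a₁ := hψ
  rw [h] at h1
  exact h1

theorem exists_galoisType_bijection {A : Type u} [τ.plus.Structure A]
    (hA : (modClass (TStar T)).Mem A) {M : CStructure τ} {i : A → M} (hi : IsCompletion A M i)
    {C : Set A} {B : Set M} (hCB : i '' C ⊆ B) (hB : B ⊆ closure (i '' C)) (ι : Type v) :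
    ∃ Φ : (modClass (TStar T)).GaloisType C ι → TypeSpace M B ι,
      Function.Bijective Φ ∧
      ∀ (t : (modClass (TStar T)).GaloisTriple A ι) (N : CStructure τ) (j : t.N → N),
        IsCompletion t.N N j →
        ∃ h : M → N, IsElementary h ∧ (∀ x : A, h (i x) = j (t.f x)) ∧
          (Φ ((modClass (TStar T)).gtp C t) : Set (CCondition τ (ι ⊕ B))) =
            typeOf N (fun b : B => h b) (fun k => j (t.a k)) := by
  have hcompl (t : (modClass (TStar T)).GaloisTriple A ι) :=
    exists_isCompletion t.strong.mem_modClass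
  choose N j _ hj using hcompl
  have hext (t : (modClass (TStar T)).GaloisTriple A ι) :=
    exists_isElementary_of_embedding hi (hj t) t.f
  choose h hh hhi using hext
  let Φ : (modClass (TStar T)).GaloisType C ι → TypeSpace M B ι :=
    Quot.lift (fun t => ⟨typeOf (N t) (fun b : B => h t b) (fun k => j t (t.a k)),
      N t, fun b => h t b, _, fun n φ x => hh t n φ fun k => (x k : M), rfl⟩)
      fun t₁ t₂ ht => Subtype.ext
        (typeOf_eq_of_atomicEq hB ht (hj t₁) (hj t₂) (hh t₁) (hh t₂) (hhi t₁) (hhi t₂))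
  -- The chosen completion of `t` and an arbitrary one give the same type: this is the previous
  -- lemma for `t` and itself.
  have hΦ (t : (modClass (TStar T)).GaloisTriple A ι) (P : CStructure τ) (l : t.N → P)
      (hl : IsCompletion t.N P l) (k : M → P) (hk : IsElementary k)
      (hki : ∀ x, k (i x) = l (t.f x)) :
      (Φ ((modClass (TStar T)).gtp C t) : Set (CCondition τ (ι ⊕ B))) =
        typeOf P (fun b : B => k b) (fun k => l (t.a k)) :=
    typeOf_eq_of_atomicEq hB (atomicEq_refl C t) (hj t) hl (hh t) hk (hhi t) hki
  refine ⟨Φ, ⟨?_, ?_⟩, fun t P l hl => ?_⟩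
  · rintro ⟨t₁⟩ ⟨t₂⟩ ht
    have hval {n : ℕ} (φ : CFormula τ n) (x : Fin n → ι ⊕ B) :=
      val_eq_of_typeOf_eq (congrArg Subtype.val ht) φ x
    -- Equal types allow amalgamation over the tuple and the parameters together, indexed by `ι ⊕
    -- B`. The atomic relation thus already holds between the two triples.
    obtain ⟨P, _, g₁, g₂, k₁, k₂, hg₁, hg₂, hgk₁, hgk₂, hP⟩ := exists_strong_amalgam
      t₁.strong.mem_modClass t₂.strong.mem_modClass (hj t₁) (hj t₂) hval
    refine Quot.sound ⟨P, _, g₁, g₂, hg₁, hg₂, fun c hc => ?_, fun k => ?_⟩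
    · rw [hgk₁, hgk₂, ← hhi, ← hhi]
      exact hP (.inr ⟨i c, hCB ⟨c, hc, rfl⟩⟩)
    · rw [hgk₁, hgk₂]
      exact hP (.inl k)
  · rintro ⟨p, P, b, a, hb, rfl⟩
    -- To realize a type over `B` in an extension of `A`, the model `P` that realizes it is
    -- amalgamated with `M` over `B`.
    obtain ⟨Q, k₁, k₂, hk₁, hk₂, hQ⟩ := exists_elementary_amalgam
      (e₁ := fun x : B => (x : M)) (e₂ := b) fun φ x => (hb _ φ x).symm
    let := plusOf Q
    obtain ⟨f, hf, hfk⟩ := exists_strong_embedding_plusOf hA hi hk₁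
    refine ⟨(modClass (TStar T)).gtp C ⟨Q, f, hf, k₂ ∘ a⟩, Subtype.ext ?_⟩
    rw [hΦ ⟨Q, f, hf, k₂ ∘ a⟩ Q id (isCompletion_plusOf Q) k₁ hk₁ fun x => (hfk x).symm]
    change typeOf Q (fun x : B => k₁ x) (k₂ ∘ a) = typeOf P b a
    rw [← typeOf_eq_of_isElementary hk₂]
    congr 1
    exact funext hQ
  · obtain ⟨k, hk, hki⟩ := exists_isElementary_of_embedding hi hl t.f
    exact ⟨k, hk, hki, hΦ t P l hl k hk hki⟩

end GaloisTypes

end ContLogic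

open ContLogic
theorem mainTheorem3 (τ : CLanguage.{u}) (T : CTheory τ) (hT : T.IsComplete) :
    -- `K` is an AEC
    (modClass (TStar T)).IsAEC ∧
    -- amalgamation over sets, joint embedding, no maximal models
    (modClass (TStar T)).AmalgamationOverSets ∧
    (modClass (TStar T)).JointEmbedding ∧
    ((∃ M : CStructure τ, CModels M T ∧ ¬ CompactSpace M) →
      (modClass (TStar T)).NoMaximalModels) ∧
    -- the members of `K` are, up to isomorphism, the `M_S` for models `M` of `T`
    (∀ (M : CStructure τ) (S : Set M) (hS : NicelyDense M S), CModels M T →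
      letI : τ.plus.Structure S := discretization M S hS
      (modClass (TStar T)).Mem S) ∧
    (∀ (A : Type u) [τ.plus.Structure A], (modClass (TStar T)).Mem A →
      ∃ (M : CStructure τ) (i : A → M), CModels M T ∧ IsCompletion A M i) ∧
    -- Galois types in `K` correspond to continuous syntactic types
    (∀ (A : Type u) [τ.plus.Structure A], (modClass (TStar T)).Mem A →
      ∀ (M : CStructure τ) (i : A → M), IsCompletion A M i →
      ∀ (C : Set A) (B : Set M), i '' C ⊆ B → B ⊆ closure (i '' C) →
      ∀ ι : Type v,
      ∃ Φ : (modClass (TStar T)).GaloisType C ι → TypeSpace M B ι,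
        Function.Bijective Φ ∧
        ∀ (t : (modClass (TStar T)).GaloisTriple A ι) (N : CStructure τ) (j : t.N → N),
          IsCompletion t.N N j →
          ∃ h : M → N, IsElementary h ∧ (∀ x : A, h (i x) = j (t.f x)) ∧
            (Φ ((modClass (TStar T)).gtp C t) : Set (CCondition τ (ι ⊕ B))) =
              typeOf N (fun b : B => h b) (fun k => j (t.a k))) :=
  ⟨isAEC_modClass T, amalgamationOverSets_modClass T, jointEmbedding_modClass hT,
    noMaximalModels_modClass hT,
    fun M S hS hM => by
      let : τ.plus.Structure S := discretization M S hS
      exact (isCompletion_discretization hS).mem_iff.2 hM,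
    fun _ _ hA => exists_isCompletion hA,
    fun _ _ hA _ _ hi _ _ hCB hB ι => exists_galoisType_bijection hA hi hCB hB ι⟩
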